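/- Let $R$ be a commutative artinian ring, let $\Lambda$ be an artin $R$-algebra (an $R$-algebra that is finitely generated as an $R$-module), and let $n\ge 0$. Modules are left modules (not necessarily finitely generated) unless said otherwise. Let $D(\Lambda)=\mathrm{Hom}_R(\Lambda,E)$, where $E$ is the injective envelope of $R/J(R)$ and $J(R)$ is the Jacobson radical of $R$, with its natural $(\Lambda,\Lambda)$-bimodule structure. Let $\mathcal B_{D(\Lambda)}(\Lambda)$ be the Bass class: the class of all $\Lambda$-modules $M$ such that $\mathrm{Ext}^i_\Lambda(D(\Lambda),M)=0$ and $\mathrm{Tor}_i^\Lambda(D(\Lambda),\mathrm{Hom}_\Lambda(D(\Lambda),M))=0$ for all $i\ge1$, and the evaluation map $D(\Lambda)\otimes_\Lambda\mathrm{Hom}_\Lambda(D(\Lambda),M)\to M$ is an isomorphism. Let $\mathcal B^\bullet_{D(\Lambda)}(\Lambda)$ be the class of complexes $M^\bullet$ of $\Lambda$-modules with bounded cohomology such that $\mathbf R\mathrm{Hom}_\Lambda(D(\Lambda),M^\bullet)$ has bounded cohomology and the canonical morphism $D(\Lambda)\otimes^{\mathbf L}_\Lambda\mathbf R\mathrm{Hom}_\Lambda(D(\Lambda),M^\bullet)\to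 M^\bullet$ is an isomorphism in the derived category. The Bass injective dimension $\mathcal B^\bullet_{D(\Lambda)}(\Lambda)\text{-}\mathrm{id}\,M^\bullet$ is $\sup\{i\in\mathbb Z\mid H^i(\mathbf R\mathrm{Hom}_\Lambda(D(\Lambda),M^\bullet))\ne0\}$ if $M^\bullet\in\mathcal B^\bullet_{D(\Lambda)}(\Lambda)$, and $+\infty$ otherwise. A module is regarded as a complex concentrated in degree $0$, and $\mathrm{id}$ denotes injective dimension. Then the following statements are equivalent. 1. $\Lambda$ is Gorenstein (that is, $\mathrm{id}\,{}_\Lambda\Lambda=\mathrm{id}\,\Lambda_\Lambda<\infty$) with $\mathrm{id}\,{}_\Lambda\Lambda=\mathrm{id}\,\Lambda_\Lambda\le n$. 2. For every simple $\Lambda$-module $T$, $\mathcal B^\bullet_{D(\Lambda)}(\Lambda)\text{-}\mathrm{id}\,T\le n$. 3. For every simple $\Lambda$-module $T$, there is a quasi-isomorphism $T\to Y^\bullet$, where $Y^\bullet$ is a bounded complex of length at most $n+1$ (that is, $Y^i=0$ outside some $n+1$ consecutive degrees) all of whose terms belong to $\mathcal B_{D(\Lambda)}(\Lambda)$. 4.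 For every simple $\Lambda$-module $T$, there is an exact sequence $0\to T\to X^T\to W^T\to0$ of $\Lambda$-modules with $X^T\in\mathcal B_{D(\Lambda)}(\Lambda)$ and $\mathrm{id}_\Lambda W^T\le n-1$ (for $n=0$ this means $W^T=0$). 5. For every simple $\Lambda$-module $T$, there is an exact sequence $0\to X_T\to W_T\to T\to0$ of $\Lambda$-modules with $X_T\in\mathcal B_{D(\Lambda)}(\Lambda)$ and $\mathrm{id}_\Lambda W_T\le n$. -/

import Mathlib

open CategoryTheory CategoryTheory.Limits
open scoped TensorProduct

universe u

/-! ### Injective envelopes -/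

/-- `j : M → E` is an injective envelope of `M`: a monomorphism into an injective module such
that every nonzero submodule of `E` meets the image of `j` nontrivially. -/
structure IsInjectiveEnvelope {R : Type u} [Ring R] {M E : Type u} [AddCommGroup M] [Module R M]
    [AddCommGroup E] [Module R E] (j : M →ₗ[R] E) : Prop where
  injective_module : Module.Injective R E
  mono : Function.Injective j
  essential : ∀ N : Submodule R E, N ⊓ LinearMap.range j = ⊥ → N = ⊥

/-- Every module has an injective envelope: a maximal essential extension inside an
injective module. -/
theorem exists_isInjectiveEnvelope (R : Type u) [Ring R] (M : Type u) [AddCommGroup M]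
    [Module R M] : ∃ (E : ModuleCat.{u} R) (j : M →ₗ[R] E), IsInjectiveEnvelope j := by
  classical
  let I : ModuleCat.{u} R := Injective.under (ModuleCat.of R M)
  let k : M →ₗ[R] I := (Injective.ι (ModuleCat.of R M)).hom
  have hk : Function.Injective k := (ModuleCat.mono_iff_injective _).1 inferInstance
  have hI : Module.Injective R I := by
    have : Injective (ModuleCat.of R I) := (inferInstance : Injective I)
    exact Module.injective_module_of_injective_object R I
  let A : Submodule R I := LinearMap.range k
  let Ess : Set (Submodule R I) :=
    {N | A ≤ N ∧ ∀ x ∈ N, x ≠ 0 → ∃ r : R, r • x ∈ A ∧ r • x ≠ 0}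
  obtain ⟨E, -, hE⟩ := zorn_le_nonempty₀ Ess (by
    intro c hc hchain N hN
    refine ⟨sSup c, ⟨(hc hN).1.trans (le_sSup hN), ?_⟩, fun z hz => le_sSup hz⟩
    intro x hx hx0
    obtain ⟨P, hP, hxP⟩ :=
      (Submodule.mem_sSup_of_directed ⟨N, hN⟩ hchain.directedOn).1 hx
    exact (hc hP).2 x hxP hx0) A ⟨le_rfl, fun x hx hx0 => ⟨1, by simpa using hx, by simpa using hx0⟩⟩
  have hAE : A ≤ E := hE.prop.1
  have hess := hE.prop.2
  obtain ⟨C, -, hC⟩ := zorn_le_nonempty₀ {C : Submodule R I | ∀ x ∈ C, x ∈ E → x = 0} (by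
    intro c hc hchain N hN
    refine ⟨sSup c, ?_, fun z hz => le_sSup hz⟩
    intro x hx hxE
    obtain ⟨P, hP, hxP⟩ :=
      (Submodule.mem_sSup_of_directed ⟨N, hN⟩ hchain.directedOn).1 hx
    exact hc hP x hxP hxE) ⊥ (by intro x hx _; simpa using hx)
  have hCE := hC.prop
  have hq : Function.Injective (C.mkQ ∘ₗ E.subtype) := by
    rw [← LinearMap.ker_eq_bot, LinearMap.ker_eq_bot']
    rintro ⟨x, hx⟩ h
    have : x ∈ C := by simpa using h
    exact Subtype.ext (hCE x this hx)
  obtain ⟨h, hh⟩ := hI.out (C.mkQ ∘ₗ E.subtype) hq E.subtype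
  let p : I →ₗ[R] I := h ∘ₗ C.mkQ
  have hpE : ∀ x ∈ E, p x = x := fun x hx => hh ⟨x, hx⟩
  have hker : LinearMap.ker p ≤ C := hC.le_of_ge (y := LinearMap.ker p)
    (by
      intro x hx hxE
      rw [← hpE x hxE]
      simpa using hx)
    (by
      intro x hx
      have : C.mkQ x = 0 := by simpa using hx
      simp only [LinearMap.mem_ker, p, LinearMap.comp_apply, this, map_zero])
  have hpC : ∀ x ∈ C, p x = 0 := by
    intro x hx
    have : C.mkQ x = 0 := by simpa using hx
    simp only [p, LinearMap.comp_apply, this, map_zero]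
  have hrange : LinearMap.range p ≤ E := hE.le_of_ge (y := LinearMap.range p)
    (by
      refine ⟨fun x hx => ⟨x, hpE x (hAE hx)⟩, ?_⟩
      rintro _ ⟨i, rfl⟩ hi
      have hiC : i ∉ C := fun h' => hi (hpC i h')
      have hnot : ¬ ∀ x ∈ C ⊔ Submodule.span R {i}, x ∈ E → x = 0 := by
        intro hall
        have := hC.le_of_ge (y := C ⊔ Submodule.span R {i}) hall le_sup_left
        exact hiC (this (Submodule.mem_sup_right (Submodule.mem_span_singleton_self i)))
      push Not at hnot
      obtain ⟨e, he, heE, he0⟩ := hnot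
      obtain ⟨c, hc, z, hz, rfl⟩ := Submodule.mem_sup.1 he
      obtain ⟨r, rfl⟩ := Submodule.mem_span_singleton.1 hz
      have hr : r • p i = c + r • i := by
        rw [← hpE _ heE, map_add, hpC c hc, zero_add, map_smul]
      obtain ⟨s, hs, hs0⟩ := hess _ heE he0
      exact ⟨s * r, by rw [mul_smul, hr]; exact hs, by rw [mul_smul, hr]; exact hs0⟩)
    (fun x hx => ⟨x, hpE x hx⟩)
  refine ⟨ModuleCat.of R E, k.codRestrict E (fun m => hAE ⟨m, rfl⟩), ⟨?_, ?_, ?_⟩⟩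
  · constructor
    intro X Y _ _ _ _ f hf g
    obtain ⟨t, ht⟩ := hI.out f hf (E.subtype ∘ₗ g)
    refine ⟨(p.codRestrict E fun m => hrange ⟨m, rfl⟩) ∘ₗ t, fun x => Subtype.ext ?_⟩
    change p (t (f x)) = _
    rw [ht]
    exact hpE _ (g x).2
  · intro a b hab
    exact hk (congrArg Subtype.val hab)
  · intro N hN
    rw [Submodule.eq_bot_iff]
    rintro ⟨x, hx⟩ hxN
    by_contra hne
    have hx0 : x ≠ 0 := fun h' => hne (Subtype.ext h')
    obtain ⟨r, ⟨m, hm⟩, hr0⟩ := hess x hx hx0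
    have hmem : r • (⟨x, hx⟩ : E) ∈ N ⊓ LinearMap.range (k.codRestrict E fun m => hAE ⟨m, rfl⟩) :=
      ⟨N.smul_mem r hxN, ⟨m, Subtype.ext hm⟩⟩
    rw [hN] at hmem
    exact hr0 (congrArg Subtype.val ((Submodule.mem_bot R).1 hmem))

/-- The injective envelope `E⁰(M)` of a module `M` (unique up to isomorphism). -/
noncomputable def injectiveEnvelope (R : Type u) [Ring R] (M : Type u) [AddCommGroup M]
    [Module R M] : ModuleCat.{u} R :=
  (exists_isInjectiveEnvelope R M).choose

theorem exists_isInjectiveEnvelope_injectiveEnvelope (R : Type u) [Ring R] (M : Type u)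
    [AddCommGroup M] [Module R M] :
    ∃ j : M →ₗ[R] injectiveEnvelope R M, IsInjectiveEnvelope j :=
  (exists_isInjectiveEnvelope R M).choose_spec

/-! ### The Matlis dual bimodule of an algebra -/

/-- `D(Λ) = Hom_R(Λ, E⁰(R/J(R)))`. -/
def MatlisDual (R Λ : Type u) [CommRing R] [Ring Λ] [Algebra R Λ] : Type u :=
  Λ →ₗ[R] injectiveEnvelope R (R ⧸ Ring.jacobson R)

namespace MatlisDual

variable {R Λ : Type u} [CommRing R] [Ring Λ] [Algebra R Λ]

noncomputable instance : AddCommGroup (MatlisDual R Λ) :=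
  inferInstanceAs (AddCommGroup (Λ →ₗ[R] injectiveEnvelope R (R ⧸ Ring.jacobson R)))

/-- The left action `(a f)(x) = f(x a)`. -/
noncomputable instance : Module Λ (MatlisDual R Λ) where
  smul a f := LinearMap.comp f (LinearMap.mulRight R a)
  one_smul f := LinearMap.ext fun x => congrArg f.toFun (mul_one x)
  mul_smul a b f := LinearMap.ext fun x => congrArg f.toFun (mul_assoc x a b).symm
  smul_zero _ := rfl
  smul_add _ _ _ := rfl
  add_smul a b f := LinearMap.ext fun x =>
    (congrArg f.toFun (mul_add x a b)).trans (f.map_add' _ _)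
  zero_smul f := LinearMap.ext fun x =>
    (congrArg f.toFun (mul_zero x)).trans (LinearMap.map_zero f)

/-- The right action `(f a)(x) = f(a x)`. -/
noncomputable instance : Module Λᵐᵒᵖ (MatlisDual R Λ) where
  smul a f := LinearMap.comp f (LinearMap.mulLeft R a.unop)
  one_smul f := LinearMap.ext fun x => congrArg f.toFun (one_mul x)
  mul_smul a b f := LinearMap.ext fun x => congrArg f.toFun (mul_assoc b.unop a.unop x)
  smul_zero _ := rfl
  smul_add _ _ _ := rfl
  add_smul a b f := LinearMap.ext fun x =>
    (congrArg f.toFun (add_mul a.unop b.unop x)).trans (f.map_add' _ _)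
  zero_smul f := LinearMap.ext fun x =>
    (congrArg f.toFun (zero_mul x)).trans (LinearMap.map_zero f)

instance : SMulCommClass Λ Λᵐᵒᵖ (MatlisDual R Λ) where
  smul_comm a b f := LinearMap.ext fun x => congrArg f.toFun (mul_assoc b.unop x a).symm

end MatlisDual

/-! ### Hom and tensor functors of a bimodule

Throughout, an `(R, S)`-bimodule is a left `R`-module and right `S`-module
(i.e. `Sᵐᵒᵖ`-module) `ω` with commuting actions. -/

section Bimodule

variable (R S : Type u) [Ring R] [Ring S] (ω : Type u) [AddCommGroup ω] [Module R ω]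
  [Module Sᵐᵒᵖ ω] [SMulCommClass R Sᵐᵒᵖ ω]

/-- Right multiplication by `s` on `ω`, as an `R`-linear map. -/
def rightMulMap (s : S) : ω →ₗ[R] ω where
  toFun x := MulOpposite.op s • x
  map_add' := smul_add _
  map_smul' r x := (smul_comm r (MulOpposite.op s) x).symm

/-- `Hom_R(ω, M)`, regarded as a left `S`-module. -/
def BimodHom (M : Type u) [AddCommGroup M] [Module R M] : Type u := ω →ₗ[R] M

namespace BimodHom

variable (M : Type u) [AddCommGroup M] [Module R M]

noncomputable instance : AddCommGroup (BimodHom R ω M) :=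
  inferInstanceAs (AddCommGroup (ω →ₗ[R] M))

/-- The left `S`-action `(s f)(x) = f(x s)`. -/
noncomputable instance : Module S (BimodHom R ω M) where
  smul s f := LinearMap.comp (σ₁₂ := RingHom.id R) (σ₂₃ := RingHom.id R) f
    (rightMulMap R S ω s)
  one_smul f := LinearMap.ext fun x => congrArg f.toFun (one_smul Sᵐᵒᵖ x)
  mul_smul s t f := LinearMap.ext fun x =>
    congrArg f.toFun (mul_smul (MulOpposite.op t) (MulOpposite.op s) x)
  smul_zero _ := rfl
  smul_add _ _ _ := rfl
  add_smul s t f := LinearMap.ext fun x =>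
    (congrArg f.toFun (add_smul (MulOpposite.op s) (MulOpposite.op t) x)).trans (f.map_add' _ _)
  zero_smul f := LinearMap.ext fun x =>
    (congrArg f.toFun (zero_smul Sᵐᵒᵖ x)).trans (LinearMap.map_zero f)

end BimodHom

/-- The functor `Hom_R(ω, -)` from left `R`-modules to left `S`-modules. -/
noncomputable def homFunctor : ModuleCat.{u} R ⥤ ModuleCat.{u} S where
  obj M := ModuleCat.of S (BimodHom R ω M)
  map {M N} g := ModuleCat.ofHom (X := BimodHom R ω M) (Y := BimodHom R ω N)
    { toFun := fun f => LinearMap.comp g.hom f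
      map_add' := fun f f' => LinearMap.comp_add f f' g.hom
      map_smul' := fun _ _ => rfl }

instance : (homFunctor R S ω).Additive where

/-- The relations `x s ⊗ y = x ⊗ s y`. The set of these relations is stable under `R`, so the
`R`-submodule they span is the additive subgroup they generate. -/
def balancedRelations (N : Type u) [AddCommGroup N] [Module S N] : Submodule R (ω ⊗[ℤ] N) :=
  Submodule.span R
    {z | ∃ (x : ω) (s : S) (y : N), z = (MulOpposite.op s • x) ⊗ₜ[ℤ] y - x ⊗ₜ[ℤ] (s • y)}

/-- The tensor product `ω ⊗_S N` over the noncommutative ring `S`, a left `R`-module. -/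
abbrev BalancedTensor (N : Type u) [AddCommGroup N] [Module S N] : Type u :=
  (ω ⊗[ℤ] N) ⧸ balancedRelations R S ω N

/-- The `R`-linear map `ω ⊗_S N → ω ⊗_S N'` induced by an `S`-linear map `N → N'`. -/
noncomputable def balancedTensorMap {N N' : Type u} [AddCommGroup N] [Module S N]
    [AddCommGroup N'] [Module S N'] (g : N →ₗ[S] N') :
    BalancedTensor R S ω N →ₗ[R] BalancedTensor R S ω N' :=
  Submodule.mapQ _ _
    (TensorProduct.AlgebraTensorModule.map (LinearMap.id : ω →ₗ[R] ω)
      g.toAddMonoidHom.toIntLinearMap) (by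
      refine Submodule.span_le.2 ?_
      rintro _ ⟨x, s, y, rfl⟩
      refine Submodule.subset_span ⟨x, s, g y, ?_⟩
      simp)

/-- The functor `ω ⊗_S -` from left `S`-modules to left `R`-modules. -/
noncomputable def tensorFunctor : ModuleCat.{u} S ⥤ ModuleCat.{u} R where
  obj N := ModuleCat.of R (BalancedTensor R S ω N)
  map g := ModuleCat.ofHom (balancedTensorMap R S ω g.hom)
  map_id N := by
    ext : 1
    refine Submodule.linearMap_qext _ (TensorProduct.AlgebraTensorModule.ext fun x y => ?_)
    rfl
  map_comp f g := by
    ext : 1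
    refine Submodule.linearMap_qext (balancedRelations R S ω _)
      (TensorProduct.AlgebraTensorModule.ext fun x y => ?_)
    rfl

instance : (tensorFunctor R S ω).Additive where
  map_add {M N f g} := by
    ext : 1
    refine Submodule.linearMap_qext _ (TensorProduct.AlgebraTensorModule.ext fun x y => ?_)
    change Submodule.Quotient.mk (p := balancedRelations R S ω N) (x ⊗ₜ[ℤ] (f.hom y + g.hom y)) =
      Submodule.Quotient.mk (p := balancedRelations R S ω N) (x ⊗ₜ[ℤ] f.hom y) +
        Submodule.Quotient.mk (p := balancedRelations R S ω N) (x ⊗ₜ[ℤ] g.hom y)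
    rw [TensorProduct.tmul_add, Submodule.Quotient.mk_add]

/-- The evaluation `θ_M : ω ⊗_S Hom_R(ω, M) → M`, `θ_M(x ⊗ f) = f(x)`. -/
noncomputable def evalMap (M : Type u) [AddCommGroup M] [Module R M] :
    BalancedTensor R S ω (BimodHom R ω M) →ₗ[R] M :=
  Submodule.liftQ _
    (TensorProduct.AlgebraTensorModule.lift
      { toFun := fun x =>
          ({ toFun := fun f : ω →ₗ[R] M => f x
             map_zero' := rfl
             map_add' := fun _ _ => rfl } : BimodHom R ω M →+ M).toIntLinearMap
        map_add' := fun x y => LinearMap.ext fun f : ω →ₗ[R] M => f.map_add x y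
        map_smul' := fun r x => LinearMap.ext fun f : ω →ₗ[R] M => f.map_smul r x }) (by
      refine Submodule.span_le.2 ?_
      rintro _ ⟨x, s, f, rfl⟩
      change _ = _
      rw [map_sub, sub_eq_zero]
      rfl)

/-- `θ` as a natural transformation. -/
noncomputable def evalTrans : homFunctor R S ω ⋙ tensorFunctor R S ω ⟶ 𝟭 (ModuleCat.{u} R) where
  app M := ModuleCat.ofHom (evalMap R S ω M)
  naturality M N g := by
    ext : 1
    refine Submodule.linearMap_qext _ (TensorProduct.AlgebraTensorModule.ext fun x y => ?_)
    rfl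

/-! ### The Bass class of modules -/

/-- The Bass class `B_ω(R)`. -/
structure IsBass (M : ModuleCat.{u} R) : Prop where
  ext_eq_zero : ∀ i : ℕ, 1 ≤ i → ∀ e : Abelian.Ext (ModuleCat.of R ω) M i, e = 0
  /-- `Tor_i^S(ω, Hom_R(ω, M)) = 0` for all `i ≥ 1`. -/
  tor_isZero : ∀ i : ℕ, 1 ≤ i →
    IsZero (((tensorFunctor R S ω).leftDerived i).obj ((homFunctor R S ω).obj M))
  static : Function.Bijective (evalMap R S ω M)

end Bimodule

/-! ### The Bass class and the Bass injective dimension of complexes -/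

section Complexes

variable {R : Type u} [Ring R]

/-- The cohomology of `M` is bounded, i.e. `M` defines an object of `D^b`. -/
def HasBoundedCohomology (M : CochainComplex (ModuleCat.{u} R) ℤ) : Prop :=
  ∃ a b : ℤ, M.IsGE a ∧ M.IsLE b

/-- `M → I` is an injective resolution: a quasi-isomorphism into a bounded below complex of
injective modules. -/
structure IsInjRes {M I : CochainComplex (ModuleCat.{u} R) ℤ} (ι : M ⟶ I) : Prop where
  quasiIso : QuasiIso ι
  injective : ∀ i : ℤ, Injective (I.X i)
  bounded : ∃ a : ℤ, I.IsStrictlyGE a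

/-- `P → N` is a projective resolution: a quasi-isomorphism from a bounded above complex of
projective modules. -/
structure IsProjRes {P N : CochainComplex (ModuleCat.{u} R) ℤ} (π : P ⟶ N) : Prop where
  quasiIso : QuasiIso π
  projective : ∀ i : ℤ, Projective (P.X i)
  bounded : ∃ b : ℤ, P.IsStrictlyLE b

end Complexes

section BimoduleComplexes

variable (R S : Type u) [Ring R] [Ring S] (ω : Type u) [AddCommGroup ω] [Module R ω]
  [Module Sᵐᵒᵖ ω] [SMulCommClass R Sᵐᵒᵖ ω]

/-- The complex `Hom_R(ω, I)`; it represents `RHom_R(ω, M)` if `I` is an injective resolution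
of `M`. -/
noncomputable abbrev homComplex (I : CochainComplex (ModuleCat.{u} R) ℤ) :
    CochainComplex (ModuleCat.{u} S) ℤ :=
  ((homFunctor R S ω).mapHomologicalComplex _).obj I

/-- The complex `ω ⊗_S P`; it represents `ω ⊗^L_S N` if `P` is a projective resolution of `N`. -/
noncomputable abbrev tensorComplex (P : CochainComplex (ModuleCat.{u} S) ℤ) :
    CochainComplex (ModuleCat.{u} R) ℤ :=
  ((tensorFunctor R S ω).mapHomologicalComplex _).obj P

/-- The evaluation `ω ⊗_S Hom_R(ω, I) → I`, degreewise `θ`. -/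
noncomputable def evalComplex (I : CochainComplex (ModuleCat.{u} R) ℤ) :
    tensorComplex R S ω (homComplex R S ω I) ⟶ I where
  f i := (evalTrans R S ω).app (I.X i)
  comm' i j _ := ((evalTrans R S ω).naturality (I.d i j)).symm

/-- The Bass class `B^•_ω(R)` of complexes: `M` and `RHom_R(ω, M)` have bounded cohomology, and
`ω ⊗^L_S RHom_R(ω, M) → M` is an isomorphism in the derived category. With an injective resolution
`ι : M → I` and a projective resolution `π : P → Hom_R(ω, I)` this last morphism is represented by
`ω ⊗_S P → ω ⊗_S Hom_R(ω, I) → I`, followed by the inverse of `ι`. -/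
def IsBassComplex (M : CochainComplex (ModuleCat.{u} R) ℤ) : Prop :=
  HasBoundedCohomology M ∧
  ∃ (I : CochainComplex (ModuleCat.{u} R) ℤ) (ι : M ⟶ I), IsInjRes ι ∧
    HasBoundedCohomology (homComplex R S ω I) ∧
    ∃ (P : CochainComplex (ModuleCat.{u} S) ℤ) (π : P ⟶ homComplex R S ω I), IsProjRes π ∧
      QuasiIso (((tensorFunctor R S ω).mapHomologicalComplex _).map π ≫ evalComplex R S ω I)

/-- `sup RHom_R(ω, M)`, the supremum of the degrees in which `RHom_R(ω, M)` has nonzero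
cohomology. (Any two injective resolutions of `M` are homotopy equivalent, so they give the same
degrees.) -/
noncomputable def supRHom (M : CochainComplex (ModuleCat.{u} R) ℤ) : EReal :=
  sSup {x | ∃ (I : CochainComplex (ModuleCat.{u} R) ℤ) (ι : M ⟶ I) (i : ℤ), IsInjRes ι ∧
    ¬ IsZero ((homComplex R S ω I).homology i) ∧ x = ((i : ℝ) : EReal)}

open Classical in
/-- The Bass injective dimension `B^•_ω(R)-id M` of a complex. -/
noncomputable def bassInjectiveDimension (M : CochainComplex (ModuleCat.{u} R) ℤ) : EReal :=
  if IsBassComplex R S ω M then supRHom R S ω M else ⊤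

end BimoduleComplexes

/-! ### Gorenstein algebras -/

/-- `Λ` is Gorenstein: the injective dimensions of `Λ` as a left and as a right module over itself
are equal and finite. -/
def IsGorensteinAlgebra (Λ : Type u) [Ring Λ] : Prop :=
  injectiveDimension (ModuleCat.of.{u} Λ Λ) = injectiveDimension (ModuleCat.of.{u} Λᵐᵒᵖ Λ) ∧
    injectiveDimension (ModuleCat.of.{u} Λ Λ) < ⊤

/-! The functors `D(Λ) ⊗ -` and `Hom(D(Λ), -)` are mutually inverse between the projective and the
injective `Λ`-modules. Each of the conditions on the simple modules yields, for every simple `T`, an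
exact sequence `0 → X → V → T → 0` with `Ext^i(D(Λ), X) = 0` for `i ≥ 1` and `V` of finite injective
dimension. For such `X` and `V` one has `Ext^i(V, X) = 0` for `i ≥ 1`, so these sequences can be
assembled along extensions and exist for all modules of finite length, in particular for `Λ`. Being
projective, `Λ` is then a direct summand of some `V`, so `id _ΛΛ < ∞`. The projective dimension of
the finitely generated module `D(Λ)` is detected by `Ext` into simple modules. It equals `id Λ_Λ` by
Matlis duality, and `id _ΛΛ` once both are finite. -/

/-! ### Pullbacks and pushouts of short exact sequences -/

section Squares

variable {C : Type*} [Category* C] [Abelian C] {S S' : ShortComplex C}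

theorem shortExact_of_isPullback (hS : S.ShortExact) {P Y : C} {a : P ⟶ S.X₂} {b : P ⟶ Y}
    {y : Y ⟶ S.X₃} (sq : IsPullback a b S.g y) :
    (ShortComplex.mk (sq.lift S.f 0 (by simp)) b (sq.lift_snd _ _ _)).ShortExact where
  exact := by
    have := hS.mono_f
    have : Mono (sq.lift S.f 0 (by simp)) := mono_of_mono_fac (sq.lift_fst S.f 0 _)
    refine ShortComplex.exact_of_f_is_kernel _ (KernelFork.IsLimit.ofι' _ _ fun k hk => ?_)
    have hkg : (k ≫ a) ≫ S.g = 0 := by rw [Category.assoc, sq.w, reassoc_of% hk, zero_comp]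
    refine ⟨hS.exact.lift (k ≫ a) hkg, sq.hom_ext ?_ ?_⟩
    · rw [Category.assoc, sq.lift_fst, hS.exact.lift_f]
    · rw [Category.assoc, sq.lift_snd, comp_zero, hk]
  mono_f := by
    have := hS.mono_f
    exact mono_of_mono_fac (sq.lift_fst S.f 0 _)
  epi_g :=
    have := hS.epi_g
    (MorphismProperty.epimorphisms C).of_isPullback sq this

theorem shortExact_comp_of_isPullback (hS : S.ShortExact) {P E : C} {i : P ⟶ E} {p : P ⟶ S.X₁}
    {e : E ⟶ S.X₂} [Epi e] (sq : IsPullback i p e S.f) :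
    (ShortComplex.mk i (e ≫ S.g) (by rw [reassoc_of% sq.w, S.zero, comp_zero])).ShortExact where
  exact := by
    have := hS.mono_f
    have : Mono i := (MorphismProperty.monomorphisms C).of_isPullback sq.flip this
    refine ShortComplex.exact_of_f_is_kernel _ (KernelFork.IsLimit.ofι' _ _ fun k hk => ?_)
    have hkg : (k ≫ e) ≫ S.g = 0 := by rw [Category.assoc, hk]
    exact ⟨sq.lift k (hS.exact.lift (k ≫ e) hkg) (hS.exact.lift_f _ _).symm, sq.lift_fst _ _ _⟩
  mono_f :=
    have := hS.mono_f
    (MorphismProperty.monomorphisms C).of_isPullback sq.flip this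
  epi_g :=
    have := hS.epi_g
    epi_comp e S.g

theorem shortExact_comp_of_isPushout (hS : S.ShortExact) {J Q : C} {j : S.X₂ ⟶ J} [Mono j]
    {r : J ⟶ Q} {q : S.X₃ ⟶ Q} (sq : IsPushout j S.g r q) :
    (ShortComplex.mk (S.f ≫ j) r
      (by rw [Category.assoc, sq.w, S.zero_assoc, zero_comp])).ShortExact where
  exact := by
    have := hS.epi_g
    have : Epi r := (MorphismProperty.epimorphisms C).of_isPushout sq this
    refine ShortComplex.exact_of_g_is_cokernel _ (CokernelCofork.IsColimit.ofπ' _ _ fun k hk => ?_)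
    have hkf : S.f ≫ j ≫ k = 0 := by rw [← Category.assoc, hk]
    exact ⟨sq.desc k (hS.exact.desc (j ≫ k) hkf) (hS.exact.g_desc _ _).symm, sq.inl_desc _ _ _⟩
  mono_f :=
    have := hS.mono_f
    mono_comp S.f j
  epi_g :=
    have := hS.epi_g
    (MorphismProperty.epimorphisms C).of_isPushout sq this

theorem isPullback_of_shortExact_of_isIso₁ (hS : S.ShortExact) (hS' : S'.ShortExact) (φ : S ⟶ S')
    [IsIso φ.τ₁] : IsPullback φ.τ₂ S.g S'.g φ.τ₃ := by
  have sq := IsPullback.of_hasPullback S'.g φ.τ₃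
  let ψ : S ⟶ ShortComplex.mk (sq.lift S'.f 0 (by simp)) (pullback.snd S'.g φ.τ₃)
      (sq.lift_snd _ _ _) :=
    { τ₁ := φ.τ₁
      τ₂ := sq.lift φ.τ₂ S.g φ.comm₂₃
      τ₃ := 𝟙 _
      comm₁₂ := sq.hom_ext (by simp [φ.comm₁₂]) (by simp)
      comm₂₃ := by simp }
  have : IsIso ψ.τ₁ := ‹IsIso φ.τ₁›
  have : IsIso ψ.τ₃ := inferInstanceAs (IsIso (𝟙 S.X₃))
  have : IsIso ψ.τ₂ :=
    ShortComplex.isIso₂_of_shortExact_of_isIso₁₃ ψ hS (shortExact_of_isPullback hS' sq)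
  exact IsPullback.of_iso_pullback ⟨φ.comm₂₃⟩ (asIso ψ.τ₂) (sq.lift_fst _ _ _) (sq.lift_snd _ _ _)

end Squares

/-! ### Dimension shifting -/

section DimensionShifting

open Abelian

variable {C : Type*} [Category* C] [Abelian C]

theorem exists_shortExact_injective [EnoughInjectives C] (X : C) :
    ∃ (I Y : C) (f : X ⟶ I) (g : I ⟶ Y) (w : f ≫ g = 0),
      Injective I ∧ (ShortComplex.mk f g w).ShortExact :=
  ⟨Injective.under X, cokernel (Injective.ι X), Injective.ι X, cokernel.π _, cokernel.condition _,
    inferInstance, { exact := ShortComplex.exact_cokernel _ }⟩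

theorem isIso₁_of_shortExact_of_isIso₂₃ {S S' : ShortComplex C} (φ : S ⟶ S') (hS : S.ShortExact)
    (hS' : S'.ShortExact) [IsIso φ.τ₂] [IsIso φ.τ₃] : IsIso φ.τ₁ := by
  have := hS.mono_f
  have := hS'.mono_f
  have lift_zero : (S'.f ≫ inv φ.τ₂) ≫ S.g = 0 := by
    rw [← cancel_mono φ.τ₃, Category.assoc, Category.assoc, ← φ.comm₂₃, IsIso.inv_hom_id_assoc,
      S'.zero, zero_comp]
  refine ⟨hS.exact.lift _ lift_zero, ?_, ?_⟩
  · rw [← cancel_mono S.f, Category.assoc, hS.exact.lift_f, φ.comm₁₂_assoc, IsIso.hom_inv_id,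
      Category.comp_id, Category.id_comp]
  · rw [← cancel_mono S'.f, Category.assoc, φ.comm₁₂, hS.exact.lift_f_assoc, Category.assoc,
      IsIso.inv_hom_id, Category.comp_id, Category.id_comp]

variable [HasExt C] {S : ShortComplex C}

theorem subsingleton_ext_right_X₁ (hS : S.ShortExact) {X : C} {n : ℕ}
    (h₃ : Subsingleton (Ext X S.X₃ n)) (h₂ : Subsingleton (Ext X S.X₂ (n + 1))) :
    Subsingleton (Ext X S.X₁ (n + 1)) := by
  refine subsingleton_of_forall_eq 0 fun e => ?_
  obtain ⟨x, rfl⟩ := Ext.covariant_sequence_exact₁ X hS e (h₂.elim _ _) rfl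
  rw [h₃.elim x 0, Ext.zero_comp]

theorem subsingleton_ext_right_X₂ (hS : S.ShortExact) {X : C} {n : ℕ}
    (h₁ : Subsingleton (Ext X S.X₁ n)) (h₃ : Subsingleton (Ext X S.X₃ n)) :
    Subsingleton (Ext X S.X₂ n) := by
  refine subsingleton_of_forall_eq 0 fun e => ?_
  obtain ⟨x, rfl⟩ := Ext.covariant_sequence_exact₂ X hS e (h₃.elim _ _)
  rw [h₁.elim x 0, Ext.zero_comp]

theorem subsingleton_ext_right_X₃ (hS : S.ShortExact) {X : C} {n : ℕ}
    (h₂ : Subsingleton (Ext X S.X₂ n)) (h₁ : Subsingleton (Ext X S.X₁ (n + 1))) :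
    Subsingleton (Ext X S.X₃ n) := by
  refine subsingleton_of_forall_eq 0 fun e => ?_
  obtain ⟨x, rfl⟩ := Ext.covariant_sequence_exact₃ X hS e rfl (h₁.elim _ _)
  rw [h₂.elim x 0, Ext.zero_comp]

theorem subsingleton_ext_left_X₁ (hS : S.ShortExact) {Y : C} {n : ℕ}
    (h₂ : Subsingleton (Ext S.X₂ Y n)) (h₃ : Subsingleton (Ext S.X₃ Y (n + 1))) :
    Subsingleton (Ext S.X₁ Y n) := by
  refine subsingleton_of_forall_eq 0 fun e => ?_
  obtain ⟨x, rfl⟩ := Ext.contravariant_sequence_exact₁ hS Y e (add_comm 1 n) (h₃.elim _ _)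
  rw [h₂.elim x 0, Ext.comp_zero]

theorem subsingleton_ext_left_X₂ (hS : S.ShortExact) {Y : C} {n : ℕ}
    (h₁ : Subsingleton (Ext S.X₁ Y n)) (h₃ : Subsingleton (Ext S.X₃ Y n)) :
    Subsingleton (Ext S.X₂ Y n) := by
  refine subsingleton_of_forall_eq 0 fun e => ?_
  obtain ⟨x, rfl⟩ := Ext.contravariant_sequence_exact₂ hS Y e (h₁.elim _ _)
  rw [h₃.elim x 0, Ext.comp_zero]

theorem exists_lift_of_subsingleton_ext (hS : S.ShortExact) {X : C}
    (h : Subsingleton (Ext X S.X₁ 1)) (f : X ⟶ S.X₃) : ∃ g : X ⟶ S.X₂, g ≫ S.g = f := by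
  obtain ⟨x, hx⟩ := Ext.covariant_sequence_exact₃ X hS (Ext.mk₀ f) rfl (h.elim _ _)
  obtain ⟨g, rfl⟩ := (Ext.mk₀_bijective _ _).2 x
  exact ⟨g, (Ext.mk₀_bijective _ _).1 (by rwa [← Ext.mk₀_comp_mk₀])⟩

theorem exists_desc_of_subsingleton_ext (hS : S.ShortExact) {Y : C}
    (h : Subsingleton (Ext S.X₃ Y 1)) (f : S.X₁ ⟶ Y) : ∃ g : S.X₂ ⟶ Y, S.f ≫ g = f := by
  obtain ⟨x, hx⟩ := Ext.contravariant_sequence_exact₁ hS Y (Ext.mk₀ f) rfl (h.elim _ _)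
  obtain ⟨g, rfl⟩ := (Ext.mk₀_bijective _ _).2 x
  exact ⟨g, (Ext.mk₀_bijective _ _).1 (by rwa [← Ext.mk₀_comp_mk₀])⟩

theorem subsingleton_ext_one_iff_exists_lift (hS : S.ShortExact) {X : C}
    (h₂ : Subsingleton (Ext X S.X₂ 1)) :
    Subsingleton (Ext X S.X₁ 1) ↔ ∀ f : X ⟶ S.X₃, ∃ g : X ⟶ S.X₂, g ≫ S.g = f := by
  refine ⟨exists_lift_of_subsingleton_ext hS, fun h => subsingleton_of_forall_eq 0 fun e => ?_⟩
  obtain ⟨x, rfl⟩ := Ext.covariant_sequence_exact₁ X hS e (h₂.elim _ _) rfl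
  obtain ⟨f, rfl⟩ := (Ext.mk₀_bijective _ _).2 x
  obtain ⟨g, rfl⟩ := h f
  rw [← Ext.mk₀_comp_mk₀, Ext.comp_assoc_of_second_deg_zero, hS.comp_extClass, Ext.comp_zero]

theorem subsingleton_ext_left_of_retract {X Y Z : C} (r : Retract X Y) {n : ℕ}
    (h : Subsingleton (Ext Y Z n)) : Subsingleton (Ext X Z n) := by
  refine subsingleton_of_forall_eq 0 fun e => ?_
  rw [← e.mk₀_id_comp, ← r.retract, ← Ext.mk₀_comp_mk₀, Ext.comp_assoc_of_second_deg_zero,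
    h.elim ((Ext.mk₀ r.r).comp e (zero_add n)) 0, Ext.comp_zero]

theorem subsingleton_ext_right_of_retract {X Y Z : C} (r : Retract X Y) {n : ℕ}
    (h : Subsingleton (Ext Z Y n)) : Subsingleton (Ext Z X n) := by
  refine subsingleton_of_forall_eq 0 fun e => ?_
  rw [← e.comp_mk₀_id, ← r.retract, ← Ext.mk₀_comp_mk₀, ← Ext.comp_assoc_of_second_deg_zero,
    h.elim (e.comp (Ext.mk₀ r.i) (add_zero n)) 0, Ext.zero_comp]

/-- The right orthogonal class `Z^⊥` of the objects `M` with `Ext^i(Z, M) = 0` for all `i ≥ 1`;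
the degree is written `i + 1` to avoid the side condition. -/
def extOrthogonal (Z : C) : ObjectProperty C := fun M => ∀ i : ℕ, Subsingleton (Ext Z M (i + 1))

namespace extOrthogonal

theorem of_injective (Z M : C) [Injective M] : extOrthogonal Z M :=
  Ext.subsingleton_of_injective Z M

theorem of_projective (Z M : C) [Projective Z] : extOrthogonal Z M :=
  Ext.subsingleton_of_projective Z M

instance (Z : C) : (extOrthogonal Z).IsClosedUnderExtensions where
  prop_X₂_of_shortExact hS h₁ h₃ i := subsingleton_ext_right_X₂ hS (h₁ i) (h₃ i)

instance (Z : C) : (extOrthogonal Z).IsStableUnderRetracts where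
  of_retract r h i := subsingleton_ext_right_of_retract r (h i)

theorem X₃ {Z : C} (hS : S.ShortExact) (h₁ : extOrthogonal Z S.X₁) (h₂ : extOrthogonal Z S.X₂) :
    extOrthogonal Z S.X₃ := fun i => subsingleton_ext_right_X₃ hS (h₂ i) (h₁ (i + 1))

end extOrthogonal

end DimensionShifting

section Approximations

variable {C : Type*} [Category* C] [Abelian C] {𝒳 𝒳' 𝒱 𝒱' : ObjectProperty C} {S : ShortComplex C}

/-- `M` has a special `𝒱`-precover with kernel in `𝒳`: there is a short exact sequence
`0 → X → V → M → 0` with `X ∈ 𝒳` and `V ∈ 𝒱`. -/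
def HasPrecover (𝒳 𝒱 : ObjectProperty C) (M : C) : Prop :=
  ∃ (X V : C) (f : X ⟶ V) (g : V ⟶ M) (w : f ≫ g = 0),
    (ShortComplex.mk f g w).ShortExact ∧ 𝒳 X ∧ 𝒱 V

/-- `M` has a special `𝒳`-preenvelope with cokernel in `𝒱`: there is a short exact sequence
`0 → M → X → V → 0` with `X ∈ 𝒳` and `V ∈ 𝒱`. -/
def HasPreenvelope (𝒳 𝒱 : ObjectProperty C) (M : C) : Prop :=
  ∃ (X V : C) (f : M ⟶ X) (g : X ⟶ V) (w : f ≫ g = 0),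
    (ShortComplex.mk f g w).ShortExact ∧ 𝒳 X ∧ 𝒱 V

theorem HasPrecover.mono (h𝒳 : 𝒳 ≤ 𝒳') (h𝒱 : 𝒱 ≤ 𝒱') {M : C} :
    HasPrecover 𝒳 𝒱 M → HasPrecover 𝒳' 𝒱' M :=
  fun ⟨_, _, _, _, w, hS, hX, hV⟩ => ⟨_, _, _, _, w, hS, h𝒳 _ hX, h𝒱 _ hV⟩

theorem HasPrecover.of_iso {M N : C} (e : M ≅ N) : HasPrecover 𝒳 𝒱 M → HasPrecover 𝒳 𝒱 N :=
  fun ⟨X, V, f, g, w, hS, hX, hV⟩ => ⟨X, V, f, g ≫ e.hom, by rw [reassoc_of% w, zero_comp],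
    ShortComplex.shortExact_of_iso (S₁ := .mk f g w)
      (ShortComplex.isoMk (Iso.refl _) (Iso.refl _) e) hS, hX, hV⟩

theorem HasPrecover.exists_retract {P : C} [Projective P] :
    HasPrecover 𝒳 𝒱 P → ∃ V, 𝒱 V ∧ Nonempty (Retract P V) :=
  fun ⟨_, V, _, g, _, hS, _, hV⟩ =>
    have : Epi g := hS.epi_g
    ⟨V, hV, ⟨⟨Projective.factorThru (𝟙 P) g, g, Projective.factorThru_comp _ _⟩⟩⟩

theorem HasPrecover.hasPreenvelope_X₁ [𝒳.IsClosedUnderExtensions] (hS : S.ShortExact)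
    (h₂ : 𝒳 S.X₂) : HasPrecover 𝒳 𝒱 S.X₃ → HasPreenvelope 𝒳 𝒱 S.X₁ := by
  rintro ⟨X, V, f, g, w, hT, hX, hV⟩
  have sq := IsPullback.of_hasPullback S.g g
  exact ⟨_, _, _, _, _, shortExact_of_isPullback hS sq,
    𝒳.prop_X₂_of_shortExact (shortExact_of_isPullback hT sq.flip) hX h₂, hV⟩

theorem HasPreenvelope.hasPrecover [𝒳.IsClosedUnderExtensions] {𝒥 : ObjectProperty C}
    (h𝒳 : ∀ X, 𝒳 X → HasPrecover 𝒳 𝒥 X)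
    (h𝒱 : ∀ {T : ShortComplex C}, T.ShortExact → 𝒥 T.X₂ → 𝒱 T.X₃ → 𝒱' T.X₁) {M : C} :
    HasPreenvelope 𝒳 𝒱 M → HasPrecover 𝒳 𝒱' M := by
  rintro ⟨B, V, f, g, w, hT, hB, hV⟩
  obtain ⟨K, I, i, p, w', hI, hK, hJ⟩ := h𝒳 B hB
  have : Epi p := hI.epi_g
  have sq := IsPullback.of_hasPullback p f
  exact ⟨_, _, _, _, _, shortExact_of_isPullback hI sq, hK,
    h𝒱 (shortExact_comp_of_isPullback hT sq) hJ hV⟩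

theorem HasPrecover.X₃ [𝒳.IsClosedUnderExtensions] (hS : S.ShortExact) (h₁ : 𝒳 S.X₁) :
    HasPrecover 𝒳 𝒱 S.X₂ → HasPrecover 𝒳 𝒱 S.X₃ := by
  rintro ⟨X, V, f, g, w, hT, hX, hV⟩
  have : Epi g := hT.epi_g
  have sq := IsPullback.of_hasPullback g S.f
  exact ⟨_, _, _, _, _, shortExact_comp_of_isPullback hS sq,
    𝒳.prop_X₂_of_shortExact (shortExact_of_isPullback hT sq) hX h₁, hV⟩

variable [EnoughInjectives C] [HasExt C]

theorem HasPrecover.X₂_of_prop_X₃ [𝒱.IsClosedUnderExtensions] (h_inj : ∀ J, Injective J → 𝒳 J)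
    (h_coker : ∀ {T : ShortComplex C}, T.ShortExact → 𝒳 T.X₁ → 𝒳 T.X₂ → 𝒳 T.X₃)
    (h_ext : ∀ V X, 𝒱 V → 𝒳 X → Subsingleton (Abelian.Ext V X 1)) (hS : S.ShortExact)
    (h₃ : 𝒱 S.X₃) : HasPrecover 𝒳 𝒱 S.X₁ → HasPrecover 𝒳 𝒱 S.X₂ := by
  rintro ⟨X, V, f, g, w, hT, hX, hV⟩
  have : Epi g := hT.epi_g
  let ι := Injective.ι V
  have po := IsPushout.of_hasPushout ι g
  have hQ := shortExact_comp_of_isPushout hT po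
  have : Epi (pushout.inl ι g) := hQ.epi_g
  have hQ𝒳 : 𝒳 (pushout ι g) := h_coker hQ hX (h_inj _ inferInstance)
  obtain ⟨q, hq⟩ := exists_desc_of_subsingleton_ext hS (h_ext _ _ h₃ hQ𝒳) (pushout.inr ι g)
  have sq := IsPullback.of_hasPullback (pushout.inl ι g) q
  have sqV : IsPullback ι g (pushout.inl ι g) (S.f ≫ q) := by
    rw [hq]
    exact isPullback_of_shortExact_of_isIso₁ hT hQ
      { τ₁ := 𝟙 X, τ₂ := ι, τ₃ := pushout.inr ι g, comm₁₂ := Category.id_comp _, comm₂₃ := po.w }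
  exact ⟨_, _, _, _, _, shortExact_of_isPullback hQ sq, hX, 𝒱.prop_X₂_of_shortExact
    (shortExact_comp_of_isPullback hS (IsPullback.of_right' sqV sq)) hV h₃⟩

theorem HasPrecover.X₂ [𝒳.IsClosedUnderExtensions] [𝒱.IsClosedUnderExtensions]
    (h_inj : ∀ J, Injective J → 𝒳 J)
    (h_coker : ∀ {T : ShortComplex C}, T.ShortExact → 𝒳 T.X₁ → 𝒳 T.X₂ → 𝒳 T.X₃)
    (h_ext : ∀ V X, 𝒱 V → 𝒳 X → Subsingleton (Abelian.Ext V X 1)) (hS : S.ShortExact)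
    (h₁ : HasPrecover 𝒳 𝒱 S.X₁) : HasPrecover 𝒳 𝒱 S.X₃ → HasPrecover 𝒳 𝒱 S.X₂ := by
  rintro ⟨X, V, f, g, w, hT, hX, hV⟩
  have sq := IsPullback.of_hasPullback S.g g
  have := h₁.X₂_of_prop_X₃ h_inj h_coker h_ext (shortExact_of_isPullback hS sq) hV
  exact this.X₃ (shortExact_of_isPullback hT sq.flip) hX

end Approximations

/-! ### Dualizing adjunctions -/

section Dualizing

open Abelian

variable {C D : Type*} [Category* C] [Category* D] [Abelian D]
  {F : C ⥤ D} {G : D ⥤ C} {adj : F ⊣ G} {W : D} {A : C}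

/-- An adjunction `F ⊣ G` that restricts to an equivalence between the projective and the injective
objects, with a projective object `A` such that `F A` is a cogenerator and an object `W` such that
`G` preserves the epimorphisms which `Hom(W, -)` preserves. It models `F = D(Λ) ⊗ -`,
`G = Hom(D(Λ), -)`, `A = Λ` and `W = D(Λ)`. -/
structure IsDualizing (adj : F ⊣ G) (W : D) (A : C) : Prop where
  isIso_unit : ∀ (P : C) [Projective P], IsIso (adj.unit.app P)
  isIso_counit : ∀ (I : D) [Injective I], IsIso (adj.counit.app I)
  injective : ∀ (P : C) [Projective P], Injective (F.obj P)
  projective : ∀ (I : D) [Injective I], Projective (G.obj I)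
  projective_regular : Projective A
  isZero : ∀ X : D, (∀ f : X ⟶ F.obj A, f = 0) → IsZero X
  epi_iff : ∀ {X Y : D} (g : X ⟶ Y), Epi (G.map g) ↔ ∀ f : W ⟶ Y, ∃ f' : W ⟶ X, f' ≫ g = f

namespace IsDualizing

theorem exists_map_eq (h : IsDualizing adj W A) {B P : C} [Projective P]
    (f : F.obj B ⟶ F.obj P) : ∃ g : B ⟶ P, F.map g = f := by
  have := h.isIso_unit P
  refine ⟨adj.homEquiv _ _ f ≫ inv (adj.unit.app P), (adj.homEquiv _ _).injective ?_⟩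
  rw [Adjunction.homEquiv_unit, Adjunction.unit_naturality, Category.assoc, IsIso.inv_hom_id,
    Category.comp_id]

theorem map_injective (h : IsDualizing adj W A) {B P : C} [Projective P] {g g' : B ⟶ P}
    (hg : F.map g = F.map g') : g = g' := by
  have := h.isIso_unit P
  exact (cancel_mono (adj.unit.app P)).1 ((adj.unit_naturality g).symm.trans
    ((congrArg (adj.unit.app B ≫ G.map ·) hg).trans (adj.unit_naturality g')))

end IsDualizing

variable [Abelian C]

/-- The Bass class of an adjunction `F ⊣ G`, for `W` and `A` as in `IsDualizing`. The vanishing of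
`Tor_i(D(Λ), G X)` is encoded as the vanishing of `Ext^i(G X, A)`, which is equivalent to it by
`IsDualizing.isZero_leftDerived_iff`. -/
structure IsBassObject [HasExt C] [HasExt D] (adj : F ⊣ G) (W : D) (A : C) (X : D) : Prop where
  orthogonal : extOrthogonal W X
  orthogonal_right : extOrthogonal (G.obj X) A
  isIso_counit : IsIso (adj.counit.app X)

theorem IsDualizing.isBassObject_of_injective [HasExt C] [HasExt D] (h : IsDualizing adj W A)
    (I : D) [Injective I] : IsBassObject adj W A I :=
  have := h.projective I
  ⟨extOrthogonal.of_injective W I, extOrthogonal.of_projective (G.obj I) A, h.isIso_counit I⟩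

theorem isBassObject_obj [HasExt C] [HasExt D] {N : C} [IsIso (adj.unit.app N)]
    (hN : extOrthogonal N A) (hFN : extOrthogonal W (F.obj N)) :
    IsBassObject adj W A (F.obj N) where
  orthogonal := hFN
  orthogonal_right i :=
    subsingleton_ext_left_of_retract (asIso (adj.unit.app N)).symm.retract (hN i)
  isIso_counit := IsIso.of_isIso_fac_left (h := 𝟙 _) (adj.left_triangle_components N)

namespace IsDualizing

variable [F.Additive]

theorem exact_map_iff (h : IsDualizing adj W A) (S : ShortComplex C) :
    (S.map F).Exact ↔ ∀ f : S.X₂ ⟶ A, S.f ≫ f = 0 → ∃ g, S.g ≫ g = f := by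
  have := h.projective_regular
  have := h.injective A
  constructor
  · intro hS f hf
    have map_zero : F.map S.f ≫ F.map f = 0 := by rw [← Functor.map_comp, hf, Functor.map_zero]
    obtain ⟨g, hg⟩ := h.exists_map_eq (hS.descToInjective _ map_zero)
    refine ⟨g, h.map_injective ?_⟩
    rw [Functor.map_comp, hg]
    exact hS.comp_descToInjective _ map_zero
  · intro hS
    rw [ShortComplex.exact_iff_isZero_homology]
    refine h.isZero _ fun φ => ?_
    let ψ : (S.map F).opcycles ⟶ F.obj A := Injective.factorThru φ (S.map F).homologyι
    obtain ⟨f, hf⟩ := h.exists_map_eq ((S.map F).pOpcycles ≫ ψ)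
    obtain ⟨g, rfl⟩ := hS f (h.map_injective (by
      rw [Functor.map_comp, hf, F.map_zero]
      exact (S.map F).f_pOpcycles_assoc ψ |>.trans zero_comp))
    have fac : ψ = (S.map F).fromOpcycles ≫ F.map g :=
      (cancel_epi (S.map F).pOpcycles).1 (hf.symm.trans
        ((F.map_comp _ _).trans ((S.map F).p_fromOpcycles_assoc (F.map g)).symm))
    rw [← Injective.comp_factorThru φ (S.map F).homologyι]
    exact (congrArg ((S.map F).homologyι ≫ ·) fac).trans
      (((S.map F).homologyι_comp_fromOpcycles_assoc (F.map g)).trans zero_comp)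

theorem isZero_leftDerived_iff [EnoughProjectives C] [HasExt C] (h : IsDualizing adj W A) (N : C)
    (i : ℕ) : IsZero ((F.leftDerived (i + 1)).obj N) ↔ Subsingleton (Ext N A (i + 1)) := by
  let P := ProjectiveResolution.of N
  rw [(P.isoLeftDerivedObj F (i + 1)).isZero_iff]
  change IsZero (HomologicalComplex.homology _ _) ↔ _
  rw [← HomologicalComplex.exactAt_iff_isZero_homology,
    HomologicalComplex.exactAt_iff' _ (i + 2) (i + 1) i (by simp) (by simp)]
  refine (h.exact_map_iff (P.complex.sc' (i + 2) (i + 1) i)).trans ⟨fun hP => ?_, fun hN => ?_⟩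
  · refine subsingleton_of_forall_eq 0 fun e => ?_
    obtain ⟨f, hf, rfl⟩ := P.extMk_surjective e (i + 2) rfl
    exact (P.extMk_eq_zero_iff f _ rfl hf i rfl).2 (hP f hf)
  · exact fun f hf => (P.extMk_eq_zero_iff f (i + 2) rfl hf i rfl).1 (hN.elim _ _)

theorem map_shortExact [HasExt C] (h : IsDualizing adj W A) {S : ShortComplex C}
    (hS : S.ShortExact) (h₃ : Subsingleton (Ext S.X₃ A 1)) : (S.map F).ShortExact where
  exact := by
    have := adj.leftAdjoint_preservesColimits
    have := hS.epi_g
    exact hS.exact.map_of_epi_of_preservesCokernel F inferInstance inferInstance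
  mono_f := by
    have exact_map := (h.exact_map_iff (ShortComplex.mk (0 : S.X₁ ⟶ S.X₁) S.f zero_comp)).2
      fun f _ => exists_desc_of_subsingleton_ext hS h₃ f
    exact (ShortComplex.exact_iff_mono _ (F.map_zero _ _)).1 exact_map
  epi_g := by
    have := adj.leftAdjoint_preservesColimits
    have := hS.epi_g
    exact inferInstanceAs (Epi (F.map S.g))

theorem exists_shortExact_homEquiv_symm [HasExt C] (h : IsDualizing adj W A) {K P : C} {X : D}
    {k : K ⟶ P} {p : P ⟶ G.obj X} {w : k ≫ p = 0} (hp : (ShortComplex.mk k p w).ShortExact)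
    [IsIso (adj.counit.app X)] (hX : Subsingleton (Ext (G.obj X) A 1)) :
    ∃ w', (ShortComplex.mk (F.map k) ((adj.homEquiv P X).symm p) w').ShortExact :=
  ⟨by rw [← Adjunction.homEquiv_naturality_left_symm, w, adj.homEquiv_counit, F.map_zero,
      zero_comp],
    ShortComplex.shortExact_of_iso (S₁ := (ShortComplex.mk k p w).map F)
      (ShortComplex.isoMk (Iso.refl _) (Iso.refl _)
        (asIso (adj.counit.app X) : F.obj (G.obj X) ≅ X)
        ((Category.id_comp _).trans (Category.comp_id _).symm)
        ((Category.id_comp _).trans (adj.homEquiv_counit ..))) (h.map_shortExact hp hX)⟩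

end IsDualizing

namespace IsDualizing

variable [G.Additive]

theorem map_right_shortExact [HasExt D] (h : IsDualizing adj W A) {S : ShortComplex D}
    (hS : S.ShortExact) (h₁ : Subsingleton (Ext W S.X₁ 1)) : (S.map G).ShortExact where
  exact := by
    have := adj.rightAdjoint_preservesLimits
    have := hS.mono_f
    exact hS.exact.map_of_mono_of_preservesKernel G inferInstance inferInstance
  mono_f := by
    have := adj.rightAdjoint_preservesLimits
    have := hS.mono_f
    exact inferInstanceAs (Mono (G.map S.f))
  epi_g := (h.epi_iff S.g).2 (exists_lift_of_subsingleton_ext hS h₁)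

theorem extOrthogonal_map_of_hasInjectiveDimensionLT [HasExt C] [HasExt D] [EnoughInjectives D]
    (h : IsDualizing adj W A) {d : ℕ} (hd : HasInjectiveDimensionLT A d) {X : D}
    (hX : extOrthogonal W X) : extOrthogonal (G.obj X) A := by
  suffices key : ∀ (m : ℕ) (X : D), extOrthogonal W X → ∀ i, d ≤ i + 1 + m →
      Subsingleton (Ext (G.obj X) A (i + 1)) from fun i => key d X hX i (by lia)
  intro m
  induction m with
  | zero => exact fun X _ i hi => HasInjectiveDimensionLT.subsingleton A d (i + 1) hi _
  | succ m ih =>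
    intro X hX i hi
    obtain ⟨I, Y, f, g, w, _, hS⟩ := exists_shortExact_injective X
    have hY : extOrthogonal W Y := .X₃ hS hX (.of_injective W I)
    have := h.projective I
    exact subsingleton_ext_left_X₁ (h.map_right_shortExact hS (hX 0))
      (extOrthogonal.of_projective (G.obj I) A i) (ih Y hY (i + 1) (by lia))

theorem subsingleton_ext_of_injective_of_extOrthogonal [HasExt D] [EnoughInjectives D]
    (h : IsDualizing adj W A) (I : D) [Injective I] {X : D}
    (hX : extOrthogonal W X) (i : ℕ) : Subsingleton (Ext I X (i + 1)) := by
  obtain ⟨J, Y, f, g, w, _, hS⟩ := exists_shortExact_injective X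
  induction i generalizing X J Y with
  | zero =>
    refine (subsingleton_ext_one_iff_exists_lift hS
      (extOrthogonal.of_injective I J 0)).2 fun k => ?_
    have := h.projective I
    have := h.isIso_counit I
    have : Epi (G.map g) := (h.map_right_shortExact hS (hX 0)).epi_g
    let l : G.obj I ⟶ G.obj J := Projective.factorThru (G.map k) (G.map g)
    refine ⟨inv (adj.counit.app I) ≫ F.map l ≫ adj.counit.app J,
      (cancel_epi (adj.counit.app I)).1 ?_⟩
    calc adj.counit.app I ≫ (inv (adj.counit.app I) ≫ F.map l ≫ adj.counit.app J) ≫ g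
      _ = F.map l ≫ adj.counit.app J ≫ g := by simp only [Category.assoc, IsIso.hom_inv_id_assoc]
      _ = F.map l ≫ F.map (G.map g) ≫ adj.counit.app Y :=
        congrArg (F.map l ≫ ·) (adj.counit_naturality g).symm
      _ = F.map (G.map k) ≫ adj.counit.app Y := by
        rw [← Projective.factorThru_comp (G.map k) (G.map g), F.map_comp, Category.assoc]
      _ = adj.counit.app I ≫ k := adj.counit_naturality k
  | succ i ih =>
    have hY : extOrthogonal W Y := .X₃ hS hX (.of_injective W J)
    obtain ⟨J', Y', f', g', w', _, hS'⟩ := exists_shortExact_injective Y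
    exact subsingleton_ext_right_X₁ hS (ih hY J' Y' f' g' w' ‹_› hS')
      (extOrthogonal.of_injective I J (i + 1))

theorem subsingleton_ext_of_hasInjectiveDimensionLT_of_extOrthogonal [HasExt D]
    [EnoughInjectives D] (h : IsDualizing adj W A) {d : ℕ} {V : D}
    (hV : HasInjectiveDimensionLT V d) {X : D} (hX : extOrthogonal W X) (i : ℕ) :
    Subsingleton (Ext V X (i + 1)) := by
  induction d generalizing V i with
  | zero =>
    have := (isZero_of_hasInjectiveDimensionLT_zero V).hasProjectiveDimensionLT_zero
    exact HasProjectiveDimensionLT.subsingleton V 0 _ (Nat.zero_le _) X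
  | succ d ih =>
    cases d with
    | zero =>
      have : Injective V := injective_iff_hasInjectiveDimensionLT_one.2 hV
      exact h.subsingleton_ext_of_injective_of_extOrthogonal V hX i
    | succ d =>
      obtain ⟨J, Y, f, g, w, _, hS⟩ := exists_shortExact_injective V
      exact subsingleton_ext_left_X₁ hS (h.subsingleton_ext_of_injective_of_extOrthogonal J hX i)
        (ih ((hS.hasInjectiveDimensionLT_X₃_iff d ‹_›).2 hV) (i + 1))

end IsDualizing

/-- The counit of an adjunction, on a short complex. -/
@[simps]
def counitShortComplex [F.Additive] [G.Additive] (adj : F ⊣ G) (S : ShortComplex D) :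
    S.map (G ⋙ F) ⟶ S where
  τ₁ := adj.counit.app S.X₁
  τ₂ := adj.counit.app S.X₂
  τ₃ := adj.counit.app S.X₃
  comm₁₂ := (adj.counit.naturality S.f).symm
  comm₂₃ := (adj.counit.naturality S.g).symm

namespace IsDualizing

variable [F.Additive] [G.Additive] [HasExt C] [HasExt D] (h : IsDualizing adj W A)

include h

theorem map_comp_shortExact {S : ShortComplex D} (hS : S.ShortExact) (h₁ : extOrthogonal W S.X₁)
    (h₃ : extOrthogonal (G.obj S.X₃) A) : (S.map (G ⋙ F)).ShortExact :=
  h.map_shortExact (h.map_right_shortExact hS (h₁ 0)) (h₃ 0)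

theorem isClosedUnderExtensions :
    ObjectProperty.IsClosedUnderExtensions (IsBassObject adj W A) where
  prop_X₂_of_shortExact {S} hS h₁ h₃ :=
    { orthogonal := (extOrthogonal W).prop_X₂_of_shortExact hS h₁.orthogonal h₃.orthogonal
      orthogonal_right i := subsingleton_ext_left_X₂
        (h.map_right_shortExact hS (h₁.orthogonal 0)) (h₁.orthogonal_right i)
        (h₃.orthogonal_right i)
      isIso_counit := by
        have : IsIso (counitShortComplex adj S).τ₁ := h₁.isIso_counit
        have : IsIso (counitShortComplex adj S).τ₃ := h₃.isIso_counit
        exact ShortComplex.isIso₂_of_shortExact_of_isIso₁₃ (counitShortComplex adj S)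
          (h.map_comp_shortExact hS h₁.orthogonal h₃.orthogonal_right) hS }

theorem mono_counit_of_extOrthogonal [EnoughInjectives D] {d : ℕ}
    (hd : HasInjectiveDimensionLT A d) {X : D} (hX : extOrthogonal W X) :
    Mono (adj.counit.app X) := by
  obtain ⟨I, Y, f, g, w, _, hS⟩ := exists_shortExact_injective X
  have hY : extOrthogonal W Y := .X₃ hS hX (.of_injective W I)
  have : Mono ((G ⋙ F).map f) := (h.map_comp_shortExact hS hX
    (h.extOrthogonal_map_of_hasInjectiveDimensionLT hd hY)).mono_f
  have := h.isIso_counit I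
  have : Mono (adj.counit.app X ≫ f) := by
    rw [← Functor.id_map f, ← adj.counit.naturality f]
    exact mono_comp _ _
  exact mono_of_mono _ f

theorem isBassObject_of_extOrthogonal [EnoughInjectives D] {d : ℕ}
    (hd : HasInjectiveDimensionLT A d) {X : D} (hX : extOrthogonal W X) :
    IsBassObject adj W A X where
  orthogonal := hX
  orthogonal_right := h.extOrthogonal_map_of_hasInjectiveDimensionLT hd hX
  isIso_counit := by
    obtain ⟨I, Y, f, g, w, _, hS⟩ := exists_shortExact_injective X
    have hY : extOrthogonal W Y := .X₃ hS hX (.of_injective W I)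
    have : Epi g := hS.epi_g
    have : IsIso (adj.counit.app I) := h.isIso_counit I
    have : Epi (adj.counit.app Y) := by
      have : Epi ((G ⋙ F).map g ≫ adj.counit.app Y) := by
        rw [adj.counit.naturality g]
        exact epi_comp (adj.counit.app I) g
      exact epi_of_epi ((G ⋙ F).map g) _
    have := h.mono_counit_of_extOrthogonal hd hY
    have : IsIso (counitShortComplex adj (.mk f g w)).τ₂ := ‹IsIso (adj.counit.app I)›
    have : IsIso (counitShortComplex adj (.mk f g w)).τ₃ := isIso_of_mono_of_epi (adj.counit.app Y)
    exact isIso₁_of_shortExact_of_isIso₂₃ (counitShortComplex adj (.mk f g w))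
      (h.map_comp_shortExact hS hX (h.extOrthogonal_map_of_hasInjectiveDimensionLT hd hY)) hS

/-- The kernel is `F K` for a projective presentation `0 → K → P → G X → 0`. -/
theorem hasPrecover_isInjective [EnoughProjectives C] {X : D} (hX : IsBassObject adj W A X) :
    HasPrecover (IsBassObject adj W A) (isInjective D) X := by
  have := hX.isIso_counit
  let P := Projective.over (G.obj X)
  let p : P ⟶ G.obj X := Projective.π (G.obj X)
  have hp : (ShortComplex.mk (kernel.ι p) p (kernel.condition p)).ShortExact :=
    { exact := ShortComplex.exact_kernel p }
  obtain ⟨w, hFp⟩ := h.exists_shortExact_homEquiv_symm hp (hX.orthogonal_right 0)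
  have fac : adj.unit.app P ≫ G.map ((adj.homEquiv P X).symm p) = p :=
    (adj.homEquiv_unit ..).symm.trans (Equiv.apply_symm_apply _ _)
  have : Injective (F.obj P) := h.injective P
  have : Epi (G.map ((adj.homEquiv P X).symm p)) := epi_of_epi_fac fac
  have orthogonal : extOrthogonal W (F.obj (kernel p))
    | 0 => (subsingleton_ext_one_iff_exists_lift hFp (extOrthogonal.of_injective W _ 0)).2
        ((h.epi_iff _).1 this)
    | i + 1 => subsingleton_ext_right_X₁ hFp (hX.orthogonal i)
        (extOrthogonal.of_injective W _ (i + 1))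
  have : IsIso (adj.unit.app (kernel p)) := by
    let φ : ShortComplex.mk (kernel.ι p) p (kernel.condition p) ⟶
        (ShortComplex.mk _ _ w).map G :=
      { τ₁ := adj.unit.app _, τ₂ := adj.unit.app _, τ₃ := 𝟙 _
        comm₁₂ := (adj.unit.naturality (kernel.ι p)).symm
        comm₂₃ := fac.trans (Category.comp_id p).symm }
    have : IsIso φ.τ₂ := h.isIso_unit P
    have : IsIso φ.τ₃ := inferInstanceAs (IsIso (𝟙 _))
    exact isIso₁_of_shortExact_of_isIso₂₃ φ hp (h.map_right_shortExact hFp (orthogonal 0))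
  have hK : extOrthogonal (kernel p) A := fun i =>
    subsingleton_ext_left_X₁ hp (extOrthogonal.of_projective P A i) (hX.orthogonal_right (i + 1))
  exact ⟨_, _, _, _, _, hFp, isBassObject_obj hK orthogonal, h.injective P⟩

end IsDualizing

end Dualizing

/-! ### Approximations by objects of finite injective dimension -/

section FiniteInjectiveDimension

open Abelian ZeroObject

variable {D : Type*} [Category* D] [Abelian D]

/-- The class of the objects of injective dimension less than `m`. -/
def injectiveDimensionLT (D : Type*) [Category* D] [Abelian D] (m : ℕ) : ObjectProperty D :=
  fun V => HasInjectiveDimensionLT V m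

/-- The class of the objects of finite injective dimension. -/
def finiteInjectiveDimension (D : Type*) [Category* D] [Abelian D] : ObjectProperty D :=
  fun V => ∃ d, HasInjectiveDimensionLT V d

theorem injectiveDimensionLT_le_finiteInjectiveDimension (m : ℕ) :
    injectiveDimensionLT D m ≤ finiteInjectiveDimension D := fun _ hV => ⟨m, hV⟩

theorem isInjective_le_injectiveDimensionLT : isInjective D ≤ injectiveDimensionLT D 1 :=
  fun _ => injective_iff_hasInjectiveDimensionLT_one.1

instance : (finiteInjectiveDimension D).IsClosedUnderExtensions where
  prop_X₂_of_shortExact := by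
    rintro S hS ⟨d, _⟩ ⟨d', _⟩
    exact ⟨max d d', hS.hasInjectiveDimensionLT_X₂ _
      (hasInjectiveDimensionLT_of_ge _ d _ (le_max_left _ _))
      (hasInjectiveDimensionLT_of_ge _ d' _ (le_max_right _ _))⟩

theorem HasPrecover.subsingleton_ext [HasExt D] {W M : D} {m : ℕ} :
    HasPrecover (extOrthogonal W) (injectiveDimensionLT D (m + 1)) M →
      Subsingleton (Ext W M (m + 1)) :=
  fun ⟨_, V, _, _, _, hS, hX, hV⟩ =>
    have : HasInjectiveDimensionLT V (m + 1) := hV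
    subsingleton_ext_right_X₃ hS
      (HasInjectiveDimensionLT.subsingleton V (m + 1) (m + 1) le_rfl W) (hX (m + 1))

theorem HasPrecover.hasInjectiveDimensionLT {𝒳 : ObjectProperty D} {P : D} [Projective P] {d : ℕ}
    (hP : HasPrecover 𝒳 (injectiveDimensionLT D d) P) : HasInjectiveDimensionLT P d := by
  obtain ⟨V, hV, ⟨r⟩⟩ := hP.exists_retract
  have : HasInjectiveDimensionLT V d := hV
  exact r.hasInjectiveDimensionLT d

theorem HasPrecover.finiteInjectiveDimension {𝒳 : ObjectProperty D} {P : D} [Projective P]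
    (hP : HasPrecover 𝒳 (finiteInjectiveDimension D) P) : finiteInjectiveDimension D P := by
  obtain ⟨V, ⟨d, _⟩, ⟨r⟩⟩ := hP.exists_retract
  exact ⟨d, r.hasInjectiveDimensionLT d⟩

theorem HasPrecover.of_prop {𝒳 𝒱 : ObjectProperty D} (h0 : 𝒳 0) {V : D} (hV : 𝒱 V) :
    HasPrecover 𝒳 𝒱 V :=
  ⟨0, V, 0, 𝟙 V, zero_comp, (ShortComplex.Splitting.ofIsZeroOfIsIso
    (.mk (0 : (0 : D) ⟶ V) (𝟙 V) zero_comp) (isZero_zero D) inferInstance).shortExact, h0, hV⟩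

theorem HasPreenvelope.of_prop {𝒳 𝒱 : ObjectProperty D} (h0 : 𝒱 0) {X : D} (hX : 𝒳 X) :
    HasPreenvelope 𝒳 𝒱 X :=
  ⟨X, 0, 𝟙 X, 0, comp_zero, (ShortComplex.Splitting.ofIsIsoOfIsZero
    (.mk (𝟙 X) (0 : X ⟶ (0 : D)) comp_zero) inferInstance (isZero_zero D)).shortExact, hX, h0⟩

end FiniteInjectiveDimension

namespace IsDualizing

open Abelian ZeroObject

variable {C D : Type*} [Category* C] [Category* D] [Abelian C] [Abelian D]
  {F : C ⥤ D} {G : D ⥤ C} [G.Additive] {adj : F ⊣ G} {W : D} {A : C} [HasExt D]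
  (h : IsDualizing adj W A)

include h

theorem isClosedUnderExtensions_hasPrecover [EnoughInjectives D] :
    ObjectProperty.IsClosedUnderExtensions
    (HasPrecover (extOrthogonal W) (finiteInjectiveDimension D)) where
  prop_X₂_of_shortExact hS h₁ h₃ := HasPrecover.X₂ (fun J _ => .of_injective W J)
    (fun hT hX hY => .X₃ hT hX hY) (fun _ _ ⟨_, hV⟩ hX =>
      h.subsingleton_ext_of_hasInjectiveDimensionLT_of_extOrthogonal hV hX 0) hS h₁ h₃

variable [F.Additive] [HasExt C]

theorem hasPrecover_of_hasPreenvelope [EnoughProjectives C] {m : ℕ} {M : D}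
    (hM : HasPreenvelope (IsBassObject adj W A) (injectiveDimensionLT D m) M) :
    HasPrecover (IsBassObject adj W A) (injectiveDimensionLT D (m + 1)) M :=
  have := h.isClosedUnderExtensions
  hM.hasPrecover (𝒥 := injectiveDimensionLT D 1) (fun _ hX =>
    (h.hasPrecover_isInjective hX).mono le_rfl isInjective_le_injectiveDimensionLT)
    fun {S} hS (_ : HasInjectiveDimensionLT S.X₂ 1) h₃ => hS.hasInjectiveDimensionLT_X₁ m h₃
      (hasInjectiveDimensionLT_of_ge _ 1 (m + 1) (by lia))

variable [EnoughInjectives D]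

theorem hasPreenvelope_of_subsingleton_ext [EnoughProjectives C] {d : ℕ}
    (hd : HasInjectiveDimensionLT A d) {m : ℕ} {M : D}
    (hM : ∀ i, m ≤ i → Subsingleton (Ext W M (i + 1))) :
    HasPreenvelope (IsBassObject adj W A) (injectiveDimensionLT D m) M := by
  have := h.isClosedUnderExtensions
  induction m generalizing M with
  | zero =>
    exact .of_prop (isZero_zero D).hasInjectiveDimensionLT_zero
      (h.isBassObject_of_extOrthogonal hd fun i => hM i i.zero_le)
  | succ m ih =>
    obtain ⟨I, Y, f, g, w, _, hS⟩ := exists_shortExact_injective M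
    have hY : ∀ i, m ≤ i → Subsingleton (Ext W Y (i + 1)) := fun i hi =>
      subsingleton_ext_right_X₃ hS (extOrthogonal.of_injective W I i) (hM (i + 1) (by lia))
    exact (h.hasPrecover_of_hasPreenvelope (ih hY)).hasPreenvelope_X₁ hS
      (h.isBassObject_of_injective I)

end IsDualizing

/-! ### Cycles and boundaries of complexes -/

section Cycles

open HomologicalComplex

variable {C : Type*} [Category* C] [Abelian C] {ι : Type*} {c : ComplexShape ι}
  (K : HomologicalComplex C c) {i j : ι}

/-- The boundaries of a complex in degree `j`, as a subobject of the cycles. -/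
noncomputable def boundaries (j : ι) : C := kernel (K.homologyπ j)

/-- The inclusion of the boundaries of a complex into the cycles. -/
noncomputable def boundariesι (j : ι) : boundaries K j ⟶ K.cycles j := kernel.ι (K.homologyπ j)

theorem shortExact_boundaries_cycles (j : ι) :
    (ShortComplex.mk (boundariesι K j) (K.homologyπ j) (kernel.condition _)).ShortExact where
  mono_f := inferInstanceAs (Mono (kernel.ι _))
  exact := ShortComplex.exact_kernel (K.homologyπ j)

theorem exact_toCycles_homologyπ (hij : c.Rel i j) :
    (ShortComplex.mk (K.toCycles i j) (K.homologyπ j) (K.toCycles_comp_homologyπ i j)).Exact :=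
  ShortComplex.exact_of_g_is_cokernel _ (K.homologyIsCokernel i j (c.prev_eq' hij))

/-- Any epimorphism onto a subobject of the cycles which induces the differential may serve as
`p`: below, it is the projection to the boundaries or to the cycles. -/
theorem shortExact_iCycles_of_comp_eq_toCycles (hij : c.Rel i j) {Z : C} {p : K.X i ⟶ Z} [Epi p]
    {q : Z ⟶ K.cycles j} [Mono q] (hpq : p ≫ q = K.toCycles i j) :
    ∃ w, (ShortComplex.mk (K.iCycles i) p w).ShortExact := by
  have hd : p ≫ q ≫ K.iCycles j = K.d i j := by rw [reassoc_of% hpq, K.toCycles_i]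
  have w : K.iCycles i ≫ p = 0 := by
    rw [← cancel_mono (q ≫ K.iCycles j), Category.assoc, hd, K.iCycles_d, zero_comp]
  refine ⟨w, { exact := ?_ }⟩
  refine ShortComplex.exact_of_f_is_kernel _ (KernelFork.IsLimit.ofι' _ _ fun k hk => ?_)
  exact ⟨K.liftCycles k j (c.next_eq' hij) (by rw [← hd, reassoc_of% hk, zero_comp]),
    K.liftCycles_i _ _ _ _⟩

theorem exists_shortExact_iCycles_boundaries (hij : c.Rel i j) :
    ∃ (p : K.X i ⟶ boundaries K j) (w : K.iCycles i ≫ p = 0),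
      (ShortComplex.mk (K.iCycles i) p w).ShortExact :=
  let p : K.X i ⟶ boundaries K j :=
    kernel.lift (K.homologyπ j) (K.toCycles i j) (K.toCycles_comp_homologyπ i j)
  have : Epi p := (ShortComplex.exact_iff_epi_kernel_lift _).1 (exact_toCycles_homologyπ K hij)
  have : Mono (boundariesι K j) := inferInstanceAs (Mono (kernel.ι _))
  ⟨p, shortExact_iCycles_of_comp_eq_toCycles K hij (q := boundariesι K j) (kernel.lift_ι _ _ _)⟩

theorem exists_shortExact_iCycles_toCycles (hij : c.Rel i j) (hK : K.ExactAt j) :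
    ∃ w, (ShortComplex.mk (K.iCycles i) (K.toCycles i j) w).ShortExact :=
  have : Epi (K.toCycles i j) :=
    (exact_toCycles_homologyπ K hij).epi_f (hK.isZero_homology.eq_of_tgt _ _)
  shortExact_iCycles_of_comp_eq_toCycles K hij (Category.comp_id _)

end Cycles

section CochainComplex

open Abelian

variable {C : Type*} [Category* C] [Abelian C] {K : CochainComplex C ℤ}

theorem exactAt_of_quasiIso_single {T : C}
    (φ : (HomologicalComplex.single C (ComplexShape.up ℤ) 0).obj T ⟶ K) [QuasiIso φ] (i : ℤ)
    (hi : i ≠ 0) : K.ExactAt i :=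
  (exactAt_iff_of_quasiIsoAt φ i).1 (HomologicalComplex.exactAt_single_obj _ _ T i hi)

/-- The cohomology in degree `0` of a complex quasi-isomorphic to `T`. -/
noncomputable def homologyIsoOfQuasiIsoSingle {T : C}
    (φ : (HomologicalComplex.single C (ComplexShape.up ℤ) 0).obj T ⟶ K) [QuasiIso φ] :
    K.homology 0 ≅ T :=
  (isoOfQuasiIsoAt φ 0).symm ≪≫ HomologicalComplex.singleObjHomologySelfIso _ 0 T

variable [HasExt C] {W : C} {m : ℤ}

theorem subsingleton_ext_cycles_of_sub (hK : ∀ i < m, extOrthogonal W (K.X i))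
    (hex : ∀ i < m, K.ExactAt i) (k : ℕ) {i : ℤ} (hi : i < m) {j : ℕ}
    (h : Subsingleton (Ext W (K.cycles (i - k)) (j + k + 1))) :
    Subsingleton (Ext W (K.cycles i) (j + 1)) := by
  induction k generalizing i j with
  | zero => simpa using h
  | succ k ih =>
    obtain ⟨w, hS⟩ := exists_shortExact_iCycles_toCycles K (i := i - 1) (j := i) (by simp)
      (hex i hi)
    refine subsingleton_ext_right_X₃ hS (hK (i - 1) (by lia) j) (ih (by lia) ?_)
    convert h using 2 <;> grind

/-- For a complex bounded below the hypothesis `h` holds as the cycles eventually vanish, and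
for `W` of finite projective dimension as the extension groups do. -/
theorem extOrthogonal_boundaries (hK : ∀ i < m, extOrthogonal W (K.X i))
    (hex : ∀ i < m, K.ExactAt i)
    (h : ∃ k : ℕ, ∀ j, Subsingleton (Ext W (K.cycles (m - 1 - k)) (j + k + 1))) :
    extOrthogonal W (boundaries K m) := by
  obtain ⟨k, h⟩ := h
  obtain ⟨p, w, hS⟩ := exists_shortExact_iCycles_boundaries K (i := m - 1) (j := m) (by simp)
  exact .X₃ hS (fun j => subsingleton_ext_cycles_of_sub hK hex k (by lia) (h j))
    (hK (m - 1) (by lia))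

theorem extOrthogonal_boundaries_of_isStrictlyGE (hK : ∀ i < m, extOrthogonal W (K.X i))
    (hex : ∀ i < m, K.ExactAt i) (a : ℤ) [K.IsStrictlyGE a] :
    extOrthogonal W (boundaries K m) := by
  refine extOrthogonal_boundaries hK hex ⟨(m - a).toNat, fun j => ?_⟩
  have := ((K.isZero_of_isStrictlyGE a (m - 1 - (m - a).toNat) (by lia)).of_mono
    (K.iCycles _)).hasInjectiveDimensionLT_zero
  exact HasInjectiveDimensionLT.subsingleton _ 0 _ (Nat.zero_le _) W

theorem extOrthogonal_boundaries_of_hasProjectiveDimensionLT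
    (hK : ∀ i < m, extOrthogonal W (K.X i)) (hex : ∀ i < m, K.ExactAt i) (d : ℕ)
    [HasProjectiveDimensionLT W d] : extOrthogonal W (boundaries K m) :=
  extOrthogonal_boundaries hK hex
    ⟨d, fun _ => HasProjectiveDimensionLT.subsingleton W d _ (by lia) _⟩

end CochainComplex

namespace IsDualizing

variable {C D : Type*} [Category* C] [Category* D] [Abelian C] [Abelian D]
  {F : C ⥤ D} {G : D ⥤ C} [F.Additive] [G.Additive] {adj : F ⊣ G} {W : D} {A : C} [HasExt C]
  [HasExt D] [EnoughProjectives C] (h : IsDualizing adj W A) {K : CochainComplex D ℤ} {m : ℤ}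

include h

theorem hasPrecover_cycles (hK : ∀ i ≥ m, IsBassObject adj W A (K.X i))
    (hex : ∀ i > m, K.ExactAt i) {n : ℕ} [K.IsStrictlyLE (m + n)] :
    HasPrecover (IsBassObject adj W A) (injectiveDimensionLT D (n + 1)) (K.cycles m) := by
  have := h.isClosedUnderExtensions
  induction n generalizing m with
  | zero =>
    have hd : K.d m (m + 1) = 0 :=
      (K.isZero_of_isStrictlyLE (m + 0) (m + 1) (by lia)).eq_of_tgt _ _
    have := K.isIso_iCycles m (m + 1) (by simp) hd
    exact ((h.hasPrecover_isInjective (hK m le_rfl)).mono le_rfl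
      isInjective_le_injectiveDimensionLT).of_iso (asIso (K.iCycles m)).symm
  | succ n ih =>
    have : K.IsStrictlyLE (m + 1 + n) := K.isStrictlyLE_of_le (m + (n + 1 : ℕ)) _ (by lia)
    obtain ⟨w, hS⟩ := exists_shortExact_iCycles_toCycles K (i := m) (j := m + 1) rfl
      (hex _ (by lia))
    exact h.hasPrecover_of_hasPreenvelope ((ih (fun i hi => hK i (by lia)) fun i hi =>
      hex i (by lia)).hasPreenvelope_X₁ hS (hK m le_rfl))

theorem hasPrecover_homology (hK : ∀ i ≥ m, IsBassObject adj W A (K.X i))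
    (hex : ∀ i > m, K.ExactAt i) {n : ℕ} [K.IsStrictlyLE (m + n)]
    (hB : extOrthogonal W (boundaries K m)) :
    HasPrecover (extOrthogonal W) (injectiveDimensionLT D (n + 1)) (K.homology m) :=
  .X₃ (shortExact_boundaries_cycles K m) hB
    ((h.hasPrecover_cycles hK hex).mono (fun _ hX => hX.orthogonal) le_rfl)

theorem hasPrecover_of_quasiIso {T : D} (hT : ¬ IsZero T)
    (φ : (HomologicalComplex.single D (ComplexShape.up ℤ) 0).obj T ⟶ K) [QuasiIso φ] {a : ℤ}
    {n : ℕ} [K.IsStrictlyGE a] [K.IsStrictlyLE (a + n)]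
    (hK : ∀ i, IsBassObject adj W A (K.X i)) :
    HasPrecover (extOrthogonal W) (injectiveDimensionLT D (n + 1)) T := by
  have hex := exactAt_of_quasiIso_single φ
  have e := homologyIsoOfQuasiIsoSingle φ
  have ha : a ≤ 0 := by
    by_contra! ha
    exact hT ((((K.isZero_of_isStrictlyGE a 0 ha).of_mono (K.iCycles 0)).of_epi
      (K.homologyπ 0)).of_iso e.symm)
  have : K.IsStrictlyLE (0 + n) := K.isStrictlyLE_of_le (a + n) _ (by lia)
  exact (h.hasPrecover_homology (fun i _ => hK i) (fun i hi => hex i hi.ne')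
    (extOrthogonal_boundaries_of_isStrictlyGE (fun i _ => (hK i).orthogonal)
      (fun i hi => hex i hi.ne) a)).of_iso e

end IsDualizing

/-! ### Projective resolutions of complexes -/

section ProjectiveResolutions

open CochainComplex

variable {C : Type*} [Category* C] [Abelian C]

theorem quasiIso_unop_opEquivalence_inverse_map {K L : CochainComplex Cᵒᵖ ℤ} (φ : K ⟶ L)
    [QuasiIso φ] : QuasiIso ((opEquivalence C).inverse.map φ).unop := by
  rw [quasiIso_iff]
  intro m
  have h : QuasiIsoAt φ (-m) := inferInstance
  rw [quasiIsoAt_iff' φ (-(m + 1)) (-m) (-(m - 1)) (by simp; lia) (by simp; lia)] at h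
  rw [quasiIsoAt_iff' _ (m - 1) m (m + 1) (by simp) (by simp), ← ShortComplex.quasiIso_opMap_iff]
  exact h

theorem exists_quasiIso_projective [EnoughProjectives C] (K : CochainComplex C ℤ) (n : ℤ)
    [K.IsStrictlyLE n] : ∃ (P : CochainComplex C ℤ) (π : P ⟶ K),
      QuasiIso π ∧ (∀ i, Projective (P.X i)) ∧ P.IsStrictlyLE n := by
  have : ((opEquivalence C).functor.obj (.op K)).IsStrictlyGE (-n) := by
    rw [isStrictlyGE_iff]
    exact fun i hi => (K.isZero_of_isStrictlyLE n (-i) (by lia)).op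
  obtain ⟨L, i, hi, hL, hL'⟩ := Plus.modelCategoryQuillen.exists_quasiIso_injective
    ((opEquivalence C).functor.obj (.op K)) (-n)
  have := quasiIso_unop_opEquivalence_inverse_map i
  refine ⟨((opEquivalence C).inverse.obj L).unop, ((opEquivalence C).inverse.map i).unop ≫
    ((opEquivalence C).unitIso.hom.app (.op K)).unop, inferInstance, fun m => ?_, ?_⟩
  · have := hL (-m)
    exact inferInstanceAs (Projective (L.X (-m)).unop)
  · rw [isStrictlyLE_iff]
    exact fun m hm => (L.isZero_of_isStrictlyGE (-n) (-m) (by lia)).unop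

theorem quasiIso_iff_acyclic_mappingCone {K L : CochainComplex C ℤ} (φ : K ⟶ L) :
    QuasiIso φ ↔ (mappingCone φ).Acyclic := by
  rw [← HomotopyCategory.quotient_obj_mem_subcategoryAcyclic_iff_acyclic]
  refine Iff.trans ?_ ((HomotopyCategory.subcategoryAcyclic C).trW_iff_of_distinguished _
    (HomotopyCategory.mappingCone_triangleh_distinguished φ))
  rw [← HomotopyCategory.quasiIso_eq_trW_subcategoryAcyclic]
  exact (HomotopyCategory.quotient_map_mem_quasiIso_iff φ).symm

theorem projective_mappingCone_X {K L : CochainComplex C ℤ} (φ : K ⟶ L)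
    (hK : ∀ i, Projective (K.X i)) (hL : ∀ i, Projective (L.X i)) (i : ℤ) :
    Projective ((mappingCone φ).X i) := by
  have := hK (i + 1)
  have := hL i
  exact Projective.of_iso (HomologicalComplex.homotopyCofiber.XIsoBiprod φ i (i + 1) (by simp)).symm
    inferInstance

end ProjectiveResolutions

section DualizingComplexes

open Abelian

variable {C D : Type*} [Category* C] [Category* D] [Abelian C] [Abelian D]
  {F : C ⥤ D} {G : D ⥤ C} [F.Additive] {adj : F ⊣ G} {W : D} {A : C}

theorem subsingleton_ext_cycles_left [HasExt C] {d : ℕ} (hd : HasInjectiveDimensionLT A d)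
    {K : CochainComplex C ℤ} (hK : K.Acyclic) (hP : ∀ i, Projective (K.X i)) (i : ℤ) :
    Subsingleton (Ext (K.cycles i) A 1) := by
  suffices key : ∀ (k : ℕ) (i : ℤ) (j : ℕ), d ≤ j + k →
      Subsingleton (Ext (K.cycles i) A (j + 1)) from key d i 0 (by lia)
  intro k
  induction k with
  | zero => exact fun i j hj => HasInjectiveDimensionLT.subsingleton A d (j + 1) (by lia) _
  | succ k ih =>
    intro i j hj
    have := hP i
    obtain ⟨w, hS⟩ := exists_shortExact_iCycles_toCycles K (i := i) rfl (hK (i + 1))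
    exact subsingleton_ext_left_X₁ hS (extOrthogonal.of_projective (K.X i) A j)
      (ih (i + 1) (j + 1) (by lia))

theorem exists_d_comp_eq {K : CochainComplex C ℤ} [HasExt C] {i : ℤ} (hi : K.ExactAt i)
    (hi₁ : K.ExactAt (i + 1)) (hi₂ : K.ExactAt (i + 1 + 1))
    (hA : Subsingleton (Ext (K.cycles (i + 1 + 1)) A 1)) {f : K.X i ⟶ A}
    (hf : K.d (i - 1) i ≫ f = 0) : ∃ g, K.d i (i + 1) ≫ g = f := by
  obtain ⟨_, hS₀⟩ := exists_shortExact_iCycles_toCycles K (i := i - 1) (j := i) (by simp) hi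
  obtain ⟨_, hS₁⟩ := exists_shortExact_iCycles_toCycles K (i := i) rfl hi₁
  obtain ⟨_, hS₂⟩ := exists_shortExact_iCycles_toCycles K (i := i + 1) rfl hi₂
  have : Epi (K.toCycles (i - 1) i) := hS₀.epi_g
  have := hS₁.epi_g
  have hf' : K.iCycles i ≫ f = 0 := by
    rw [← cancel_epi (K.toCycles (i - 1) i), K.toCycles_i_assoc, hf, comp_zero]
  obtain ⟨g, hg⟩ := exists_desc_of_subsingleton_ext hS₂ hA (hS₁.exact.desc f hf')
  refine ⟨g, ?_⟩
  calc K.d i (i + 1) ≫ g = K.toCycles i (i + 1) ≫ K.iCycles (i + 1) ≫ g :=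
        (K.toCycles_i_assoc i (i + 1) g).symm
    _ = K.toCycles i (i + 1) ≫ hS₁.exact.desc f hf' := congrArg _ hg
    _ = f := hS₁.exact.g_desc f hf'

namespace IsDualizing

variable [HasExt C] (h : IsDualizing adj W A) {d : ℕ} (hd : HasInjectiveDimensionLT A d)
  {K L : CochainComplex C ℤ}

include h hd

theorem acyclic_map (hK : K.Acyclic) (hP : ∀ i, Projective (K.X i)) :
    ((F.mapHomologicalComplex _).obj K).Acyclic := by
  intro i
  rw [HomologicalComplex.exactAt_iff' _ (i - 1) i (i + 1) (by simp) (by simp)]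
  exact (h.exact_map_iff (K.sc' (i - 1) i (i + 1))).2 fun f hf =>
    exists_d_comp_eq (hK i) (hK (i + 1)) (hK (i + 1 + 1))
      (subsingleton_ext_cycles_left hd hK hP (i + 1 + 1)) hf

theorem quasiIso_map (φ : K ⟶ L) [QuasiIso φ] (hK : ∀ i, Projective (K.X i))
    (hL : ∀ i, Projective (L.X i)) : QuasiIso ((F.mapHomologicalComplex _).map φ) := by
  rw [quasiIso_iff_acyclic_mappingCone]
  exact fun i => (h.acyclic_map hd ((quasiIso_iff_acyclic_mappingCone φ).1 inferInstance)
    (projective_mappingCone_X φ hK hL) i).of_iso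
      (CochainComplex.mappingCone.mapHomologicalComplexIso φ F)

end IsDualizing

end DualizingComplexes

/-! ### Injective resolutions and extension groups -/

section InjectiveResolutions

open Abelian

variable {C : Type*} [Category* C] [Abelian C] [HasExt C] {K : CochainComplex C ℤ}

section

variable (hI : ∀ i, Injective (K.X i)) {a : ℤ} (ha : K.IsStrictlyGE a)
  (hex : ∀ i ≠ 0, K.ExactAt i) (W : C)

include hI ha hex

theorem subsingleton_ext_cycles_zero_iff (j : ℕ) :
    Subsingleton (Ext W (K.cycles 0) (j + 1)) ↔ Subsingleton (Ext W (K.homology 0) (j + 1)) := by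
  have hB : extOrthogonal W (boundaries K 0) := extOrthogonal_boundaries_of_isStrictlyGE
    (fun i _ => have := hI i; .of_injective W _) (fun i hi => hex i hi.ne) a
  have hS := shortExact_boundaries_cycles K 0
  exact ⟨fun h => subsingleton_ext_right_X₃ hS h (hB _),
    fun h => subsingleton_ext_right_X₂ hS (hB j) h⟩

theorem subsingleton_ext_cycles_iff (i j : ℕ) :
    Subsingleton (Ext W (K.cycles i) (j + 1)) ↔
      Subsingleton (Ext W (K.homology 0) (i + j + 1)) := by
  induction i generalizing j with
  | zero => simpa using subsingleton_ext_cycles_zero_iff hI ha hex W j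
  | succ i ih =>
    rw [show i + 1 + j + 1 = i + (j + 1) + 1 by lia, ← ih]
    obtain ⟨w, hS⟩ := exists_shortExact_iCycles_toCycles K (i := i) (j := (i + 1 : ℕ))
      (by push_cast; rfl) (hex _ (by lia))
    have := hI i
    have hX := extOrthogonal.of_injective W (K.X i)
    exact ⟨fun h => subsingleton_ext_right_X₁ hS h (hX _),
      fun h => subsingleton_ext_right_X₃ hS (hX _) h⟩

theorem exists_comp_d_iff (i : ℕ) :
    (∀ f : W ⟶ K.X (i + 1), f ≫ K.d (i + 1) (i + 1 + 1) = 0 → ∃ g, g ≫ K.d i (i + 1) = f) ↔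
      Subsingleton (Ext W (K.homology 0) (i + 1)) := by
  obtain ⟨w, hS⟩ := exists_shortExact_iCycles_toCycles K (i := i) rfl (hex _ (by lia))
  have := hI i
  rw [← subsingleton_ext_cycles_iff hI ha hex W i 0,
    subsingleton_ext_one_iff_exists_lift hS (extOrthogonal.of_injective W _ 0)]
  constructor
  · intro h f
    obtain ⟨g, hg⟩ := h (f ≫ K.iCycles (i + 1)) (by simp)
    exact ⟨g, (cancel_mono (K.iCycles ((i : ℤ) + 1))).1 (by simpa using hg)⟩
  · intro h f hf
    obtain ⟨g, hg⟩ := h (K.liftCycles f (i + 1 + 1) (by simp) hf)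
    exact ⟨g, by simpa using hg =≫ K.iCycles ((i : ℤ) + 1)⟩

end

section HomComplex

variable {Λ : Type u} [Ring Λ] {ω : Type u} [AddCommGroup ω] [Module Λ ω] [Module Λᵐᵒᵖ ω]
  [SMulCommClass Λ Λᵐᵒᵖ ω]

theorem exactAt_homComplex_iff (K : CochainComplex (ModuleCat.{u} Λ) ℤ) (i : ℤ) :
    (homComplex Λ Λ ω K).ExactAt (i + 1) ↔
      ∀ f : ModuleCat.of Λ ω ⟶ K.X (i + 1), f ≫ K.d (i + 1) (i + 1 + 1) = 0 →
        ∃ g, g ≫ K.d i (i + 1) = f := by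
  rw [HomologicalComplex.exactAt_iff' _ i (i + 1) (i + 1 + 1) (by simp) (by simp),
    ShortComplex.moduleCat_exact_iff]
  constructor
  · intro h f hf
    obtain ⟨g, hg⟩ := h (show BimodHom Λ ω (K.X (i + 1)) from f.hom)
      (congrArg ModuleCat.Hom.hom hf)
    exact ⟨ModuleCat.ofHom (show ω →ₗ[Λ] K.X i from g), ModuleCat.hom_ext hg⟩
  · intro h f hf
    obtain ⟨g, hg⟩ := h (ModuleCat.ofHom (show ω →ₗ[Λ] K.X (i + 1) from f)) (ModuleCat.hom_ext hf)
    exact ⟨(show BimodHom Λ ω (K.X i) from g.hom), congrArg ModuleCat.Hom.hom hg⟩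

theorem IsInjRes.exactAt_homComplex_iff {T : ModuleCat.{u} Λ}
    {I : CochainComplex (ModuleCat.{u} Λ) ℤ}
    {ι : (HomologicalComplex.single (ModuleCat.{u} Λ) (ComplexShape.up ℤ) 0).obj T ⟶ I}
    (h : IsInjRes ι) (i : ℕ) : (homComplex Λ Λ ω I).ExactAt (i + 1) ↔
      Subsingleton (Ext (ModuleCat.of Λ ω) T (i + 1)) := by
  obtain ⟨_, hI, a, ha⟩ := h
  rw [_root_.exactAt_homComplex_iff, exists_comp_d_iff hI ha (exactAt_of_quasiIso_single ι)]
  have e := homologyIsoOfQuasiIsoSingle ι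
  exact ⟨subsingleton_ext_right_of_retract e.symm.retract,
    subsingleton_ext_right_of_retract e.retract⟩

theorem isInjRes_injectiveResolution {T : ModuleCat.{u} Λ} (I : InjectiveResolution T) :
    IsInjRes (M := (HomologicalComplex.single (ModuleCat.{u} Λ) (ComplexShape.up ℤ) 0).obj T)
      I.ι' :=
  ⟨inferInstanceAs (QuasiIso I.ι'), fun _ => inferInstance, 0, inferInstance⟩

theorem supRHom_single_le_iff (T : ModuleCat.{u} Λ) (n : ℕ) :
    supRHom Λ Λ ω ((HomologicalComplex.single (ModuleCat.{u} Λ) (ComplexShape.up ℤ) 0).obj T) ≤ n ↔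
      ∀ i : ℕ, n ≤ i → Subsingleton (Ext (ModuleCat.of Λ ω) T (i + 1)) := by
  rw [supRHom, sSup_le_iff]
  constructor
  · intro h i hi
    have hres := isInjRes_injectiveResolution (InjectiveResolution.of T)
    rw [← hres.exactAt_homComplex_iff, HomologicalComplex.exactAt_iff_isZero_homology]
    by_contra hne
    have real_le : (((i : ℤ) + 1 : ℤ) : ℝ) ≤ (n : ℝ) :=
      EReal.coe_le_coe_iff.1 (h _ ⟨_, _, _, hres, hne, rfl⟩)
    have int_le : (i : ℤ) + 1 ≤ n := by exact_mod_cast real_le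
    lia
  · rintro h _ ⟨I, ι, i, hres, hne, rfl⟩
    by_contra! hi
    have real_lt : (n : ℝ) < (i : ℝ) := EReal.coe_lt_coe_iff.1 hi
    have int_lt : (n : ℤ) < i := by exact_mod_cast real_lt
    obtain ⟨k, rfl⟩ : ∃ k : ℕ, i = k + 1 := ⟨(i - 1).toNat, by lia⟩
    exact hne ((hres.exactAt_homComplex_iff k).2 (h k (by lia))).isZero_homology

end HomComplex

end InjectiveResolutions

/-! ### Matlis duality over a commutative artinian ring -/

section Matlis

variable {R : Type u} [CommRing R]

/-- The Matlis module `E⁰(R/J(R))`, the injective cogenerator defining the duality. -/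
noncomputable abbrev MatlisModule (R : Type u) [CommRing R] : ModuleCat.{u} R :=
  injectiveEnvelope R (R ⧸ Ring.jacobson R)

theorem MatlisModule.injective : Module.Injective R (MatlisModule R) :=
  have ⟨_, hj⟩ := exists_isInjectiveEnvelope_injectiveEnvelope R (R ⧸ Ring.jacobson R)
  hj.injective_module

theorem exists_smul_eq_of_isRadical {I : Ideal R} (hI : I.IsRadical) {S : Type*} [AddCommGroup S]
    [Module R S] [IsSimpleModule R S] {f : S →ₗ[R] R ⧸ I} (hf : f ≠ 0) (g : S →ₗ[R] R ⧸ I) :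
    ∃ r : R, r • f = g := by
  obtain ⟨s, hs⟩ := DFunLike.ne_iff.1 hf
  have hs0 : s ≠ 0 := by rintro rfl; exact hs (map_zero f)
  obtain ⟨x, hx⟩ := Ideal.Quotient.mk_surjective (f s)
  obtain ⟨y, hy⟩ := Ideal.Quotient.mk_surjective (g s)
  -- As `I` is radical, `f (x • s) = x²` is nonzero, so that `x` acts invertibly on `S`.
  have hxs : x • s ≠ 0 := by
    intro h
    have hx2 : x ^ 2 ∈ I := by
      rw [← Ideal.Quotient.eq_zero_iff_mem, pow_two, map_mul]
      nth_rw 2 [hx]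
      exact (f.map_smul x s).symm.trans ((congrArg f h).trans (map_zero f))
    exact hs (hx.symm.trans (Ideal.Quotient.eq_zero_iff_mem.2 (hI ⟨2, hx2⟩)))
  obtain ⟨b, hb⟩ := IsSimpleModule.toSpanSingleton_surjective R hxs s
  replace hb : b • x • s = s := hb
  have hfg : x • g s = y • f s := by
    rw [← hx, ← hy, Algebra.smul_def, Algebra.smul_def, mul_comm]
    rfl
  refine ⟨b * y, LinearMap.ext fun t => ?_⟩
  obtain ⟨r, rfl⟩ := IsSimpleModule.toSpanSingleton_surjective R hs0 t
  calc (b * y) • f (r • s) = r • b • y • f s := by rw [map_smul, smul_comm, mul_smul]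
    _ = r • g (b • x • s) := by rw [map_smul, map_smul, hfg]
    _ = g (r • s) := by rw [hb, map_smul]

theorem IsInjectiveEnvelope.exists_comp_eq_of_isSimpleModule {A : Type u} [Ring A]
    {M E : Type u} [AddCommGroup M] [Module A M] [AddCommGroup E] [Module A E] {j : M →ₗ[A] E}
    (hj : IsInjectiveEnvelope j) {S : Type*} [AddCommGroup S] [Module A S] [IsSimpleModule A S]
    (h : S →ₗ[A] E) : ∃ h' : S →ₗ[A] M, j ∘ₗ h' = h := by
  have hrange (s : S) : h s ∈ LinearMap.range j := by
    by_cases hh : h = 0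
    · simp only [hh, LinearMap.zero_apply, zero_mem]
    have hne : LinearMap.range h ⊓ LinearMap.range j ≠ ⊥ := fun h0 =>
      hh (LinearMap.range_eq_bot.1 (hj.essential _ h0))
    obtain ⟨_, ⟨⟨t, rfl⟩, ht⟩, ht0⟩ := Submodule.exists_mem_ne_zero_of_ne_bot hne
    obtain ⟨r, rfl⟩ := IsSimpleModule.toSpanSingleton_surjective A
      (m := t) (by rintro rfl; exact ht0 (map_zero h)) s
    exact (h.map_smul r t).symm ▸ Submodule.smul_mem _ r ht
  refine ⟨(LinearEquiv.ofInjective j hj.mono).symm ∘ₗ h.codRestrict _ hrange,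
    LinearMap.ext fun s => ?_⟩
  exact congrArg Subtype.val ((LinearEquiv.ofInjective j hj.mono).apply_symm_apply ⟨h s, hrange s⟩)

namespace MatlisModule

theorem length_dual_le_one (S : Type u) [AddCommGroup S] [Module R S] [IsSimpleModule R S] :
    Module.length R (S →ₗ[R] MatlisModule R) ≤ 1 := by
  obtain ⟨j, hj⟩ := exists_isInjectiveEnvelope_injectiveEnvelope R (R ⧸ Ring.jacobson R)
  have hJ : (Ring.jacobson R).IsRadical :=
    Ideal.jacobson_bot (R := R) ▸ Ideal.isRadical_jacobson (⊥ : Ideal R)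
  rcases subsingleton_or_nontrivial (S →ₗ[R] MatlisModule R) with h | h
  · exact (Module.length_eq_zero.trans_le zero_le)
  · have : IsSimpleModule R (S →ₗ[R] MatlisModule R) := by
      refine isSimpleModule_iff_toSpanSingleton_surjective.2 ⟨h, fun f hf g => ?_⟩
      obtain ⟨f, rfl⟩ := hj.exists_comp_eq_of_isSimpleModule f
      obtain ⟨g, rfl⟩ := hj.exists_comp_eq_of_isSimpleModule g
      obtain ⟨r, rfl⟩ := exists_smul_eq_of_isRadical hJ
        (f := f) (by rintro rfl; exact hf (LinearMap.comp_zero j)) g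
      exact ⟨r, (LinearMap.comp_smul j r f).symm⟩
    exact (Module.length_eq_one R _).le

theorem length_dual_le {M : Type u} [AddCommGroup M] [Module R M] (h : IsFiniteLength R M) :
    Module.length R (M →ₗ[R] MatlisModule R) ≤ Module.length R M := by
  induction h with
  | of_subsingleton => exact Module.length_eq_zero.trans_le zero_le
  | @of_simple_quotient M _ _ N _ _ ih =>
    have hsub : Function.Surjective (LinearMap.lcomp R (MatlisModule R) N.subtype) := fun f =>
      let ⟨g, hg⟩ := (MatlisModule.injective (R := R)).out N.subtype N.subtype_injective f
      ⟨g, LinearMap.ext hg⟩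
    calc Module.length R (M →ₗ[R] MatlisModule R)
      _ = Module.length R (M ⧸ N →ₗ[R] MatlisModule R) +
            Module.length R (N →ₗ[R] MatlisModule R) :=
          Module.length_eq_add_of_exact (LinearMap.lcomp R (MatlisModule R) N.mkQ)
            (LinearMap.lcomp R (MatlisModule R) N.subtype)
            (LinearMap.lcomp_injective_of_surjective _ N.mkQ_surjective) hsub
            (LinearMap.exact_lcomp_of_exact_of_surjective _ (LinearMap.exact_subtype_mkQ N)
              N.mkQ_surjective)
      _ ≤ 1 + Module.length R N := add_le_add (length_dual_le_one _) ih
      _ = Module.length R N + Module.length R (M ⧸ N) := by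
          rw [Module.length_eq_one R (M ⧸ N), add_comm]
      _ = Module.length R M :=
          (Module.length_eq_add_of_exact N.subtype N.mkQ N.subtype_injective
            N.mkQ_surjective (LinearMap.exact_subtype_mkQ N)).symm

variable [IsArtinianRing R]

theorem exists_injective_quotient {P : Ideal R} (hP : P.IsMaximal) :
    ∃ i : R ⧸ P →ₗ[R] MatlisModule R, Function.Injective i := by
  obtain ⟨j, hj⟩ := exists_isInjectiveEnvelope_injectiveEnvelope R (R ⧸ Ring.jacobson R)
  have hJP : Ring.jacobson R ≤ P := sInf_le (Ideal.isMaximal_def.1 hP)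
  have : IsSemisimpleModule R (R ⧸ Ring.jacobson R) :=
    (IsArtinian.isSemisimpleModule_iff_jacobson R _).2 (Module.jacobson_quotient_jacobson R R)
  obtain ⟨s, hs⟩ := IsSemisimpleModule.lifting_property (Submodule.factor hJP)
    (Submodule.factor_surjective hJP) LinearMap.id
  exact ⟨j ∘ₗ s, hj.mono.comp (Function.LeftInverse.injective (LinearMap.congr_fun hs))⟩

theorem exists_apply_ne_zero {M : Type u} [AddCommGroup M] [Module R M] {m : M} (hm : m ≠ 0) :
    ∃ f : M →ₗ[R] MatlisModule R, f m ≠ 0 := by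
  let I := LinearMap.ker (LinearMap.toSpanSingleton R M m)
  have hI : I ≠ ⊤ := fun h => hm ((one_smul R m).symm.trans ((Ideal.eq_top_iff_one I).1 h))
  obtain ⟨P, hP, hIP⟩ := Ideal.exists_le_maximal I hI
  obtain ⟨i, hi⟩ := exists_injective_quotient hP
  let k : R ⧸ I →ₗ[R] M := I.liftQ (LinearMap.toSpanSingleton R M m) le_rfl
  obtain ⟨f, hf⟩ := (MatlisModule.injective (R := R)).out k
    (LinearMap.ker_eq_bot.1 (Submodule.ker_liftQ_eq_bot _ _ _ le_rfl)) (i ∘ₗ Submodule.factor hIP)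
  have hk : k (Submodule.Quotient.mk 1) = m := one_smul R m
  refine ⟨f, fun h0 => hP.ne_top ((Ideal.eq_top_iff_one P).2 ?_)⟩
  have apply_one : i (Submodule.Quotient.mk 1) = 0 := (hf _).symm.trans ((congrArg f hk).trans h0)
  exact (Submodule.Quotient.mk_eq_zero P).1 (hi (apply_one.trans (map_zero i).symm))

variable (M : Type u) [AddCommGroup M] [Module R M] [Module.Finite R M]

theorem length_dual_le_of_finite :
    Module.length R (M →ₗ[R] MatlisModule R) ≤ Module.length R M :=
  length_dual_le (((IsArtinianRing.tfae R M).out 0 3 :).1 ‹_›)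

theorem finite_dual : Module.Finite R (M →ₗ[R] MatlisModule R) := by
  have hM : Module.length R M ≠ ⊤ :=
    Module.length_ne_top_iff.2 (((IsArtinianRing.tfae R M).out 0 3 :).1 ‹_›)
  exact ((IsArtinianRing.tfae R (M →ₗ[R] MatlisModule R)).out 0 3 :).2 (Module.length_ne_top_iff.1
    (ne_top_of_le_ne_top hM (length_dual_le_of_finite M)))

variable {M}

/-- The evaluation map of `M` into its bidual is injective, hence bijective by comparison of
lengths. -/
theorem exists_eval_eq (φ : (M →ₗ[R] MatlisModule R) →ₗ[R] MatlisModule R) :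
    ∃ m : M, ∀ f : M →ₗ[R] MatlisModule R, φ f = f m := by
  let ev : M →ₗ[R] (M →ₗ[R] MatlisModule R) →ₗ[R] MatlisModule R := LinearMap.id.flip
  have hev : Function.Injective ev := by
    refine (injective_iff_map_eq_zero ev).2 fun m hm => by_contra fun hne => ?_
    obtain ⟨f, hf⟩ := exists_apply_ne_zero (R := R) hne
    exact hf (LinearMap.congr_fun hm f)
  have := finite_dual (R := R) M
  have := finite_dual (R := R) (M →ₗ[R] MatlisModule R)
  have hle := (length_dual_le_of_finite (R := R) (M →ₗ[R] MatlisModule R)).trans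
    (length_dual_le_of_finite M)
  have hr : LinearMap.range ev = ⊤ := by
    by_contra hne
    have length_lt := Submodule.length_lt hne
    rw [← (LinearEquiv.ofInjective ev hev).length_eq] at length_lt
    exact hle.not_gt length_lt
  obtain ⟨m, hm⟩ := LinearMap.range_eq_top.1 hr φ
  exact ⟨m, fun f => (LinearMap.congr_fun hm f).symm⟩

end MatlisModule

end Matlis

/-! ### Duality between right and left modules -/

theorem shortExact_of_exact {A X Y Z : Type u} [Ring A] [AddCommGroup X] [Module A X]
    [AddCommGroup Y] [Module A Y] [AddCommGroup Z] [Module A Z] {f : X →ₗ[A] Y} {g : Y →ₗ[A] Z}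
    (hf : Function.Injective f) (hfg : Function.Exact f g) (hg : Function.Surjective g) :
    (ShortComplex.mk (ModuleCat.ofHom f) (ModuleCat.ofHom g)
      (ModuleCat.hom_ext hfg.linearMap_comp_eq_zero)).ShortExact :=
  ModuleCat.shortComplex_shortExact _ hfg hf hg

section Duality

variable {R Λ : Type u} [CommRing R] [Ring Λ] [Algebra R Λ]

namespace MatlisDual

noncomputable instance : Module R (MatlisDual R Λ) :=
  inferInstanceAs (Module R (Λ →ₗ[R] MatlisModule R))

instance : FunLike (MatlisDual R Λ) Λ (MatlisModule R) :=
  inferInstanceAs (FunLike (Λ →ₗ[R] MatlisModule R) Λ (MatlisModule R))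

instance : LinearMapClass (MatlisDual R Λ) R Λ (MatlisModule R) :=
  inferInstanceAs (LinearMapClass (Λ →ₗ[R] MatlisModule R) R Λ (MatlisModule R))

/-- A linear functional on `Λ`, as an element of `D(Λ)`. -/
def of (f : Λ →ₗ[R] MatlisModule R) : MatlisDual R Λ := f

@[ext] theorem ext {f g : MatlisDual R Λ} (h : ∀ x, f x = g x) : f = g := LinearMap.ext h

@[simp] theorem smul_apply (a : Λ) (f : MatlisDual R Λ) (x : Λ) : (a • f) x = f (x * a) := rfl

@[simp] theorem op_smul_apply (a : Λᵐᵒᵖ) (f : MatlisDual R Λ) (x : Λ) :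
    (a • f) x = f (a.unop * x) := rfl

@[simp] theorem algebra_smul_apply (r : R) (f : MatlisDual R Λ) (x : Λ) : (r • f) x = r • f x := rfl

instance : IsScalarTower R Λ (MatlisDual R Λ) where
  smul_assoc r a f := by ext x; simp

instance : IsScalarTower R Λᵐᵒᵖ (MatlisDual R Λ) where
  smul_assoc r a f := by ext x; simp

/-- The evaluation of the functionals in `D(Λ)` at an element of `Λ`. -/
def eval (x : Λ) : MatlisDual R Λ →ₗ[R] MatlisModule R where
  toFun f := f x
  map_add' _ _ := rfl
  map_smul' _ _ := rfl

@[simp] theorem eval_apply (x : Λ) (f : MatlisDual R Λ) : eval x f = f x := rfl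

theorem injective_right : Module.Injective Λᵐᵒᵖ (MatlisDual R Λ) := by
  refine Module.Baer.injective fun I g => ?_
  obtain ⟨ψ, hψ⟩ := (MatlisModule.injective (R := R)).out (I.subtype.restrictScalars R)
    Subtype.val_injective (eval 1 ∘ₗ g.restrictScalars R)
  refine ⟨LinearMap.toSpanSingleton Λᵐᵒᵖ (MatlisDual R Λ)
    (of (ψ ∘ₗ (MulOpposite.opLinearEquiv R).toLinearMap)), fun x hx => ext fun y => ?_⟩
  have apply_one := hψ (MulOpposite.op y • ⟨x, hx⟩)
  simp only [LinearMap.restrictScalars_apply, LinearMap.comp_apply, eval_apply, map_smul,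
    op_smul_apply, MulOpposite.unop_op, mul_one] at apply_one
  exact apply_one

theorem injective_left : Module.Injective Λ (MatlisDual R Λ) := by
  refine Module.Baer.injective fun I g => ?_
  obtain ⟨ψ, hψ⟩ := (MatlisModule.injective (R := R)).out (I.subtype.restrictScalars R)
    Subtype.val_injective (eval 1 ∘ₗ g.restrictScalars R)
  refine ⟨LinearMap.toSpanSingleton Λ (MatlisDual R Λ) (of ψ), fun x hx => ext fun y => ?_⟩
  have apply_one := hψ (y • ⟨x, hx⟩)
  simp only [LinearMap.restrictScalars_apply, LinearMap.comp_apply, eval_apply, map_smul,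
    smul_apply, one_mul] at apply_one
  exact apply_one

variable [IsArtinianRing R]

theorem eq_of_forall_apply_eq {x y : Λ} (h : ∀ f : MatlisDual R Λ, f x = f y) : x = y := by
  by_contra hne
  obtain ⟨f, hf⟩ := MatlisModule.exists_apply_ne_zero (R := R) (sub_ne_zero.2 hne)
  exact hf (by rw [map_sub, sub_eq_zero]; exact h (of f))

variable [Module.Finite R Λ]

theorem finite : Module.Finite R (MatlisDual R Λ) := MatlisModule.finite_dual Λ

instance : Module.Finite Λ (MatlisDual R Λ) :=
  have := finite (R := R) (Λ := Λ)
  Module.Finite.of_restrictScalars_finite R Λ _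

theorem exists_eval_eq (φ : MatlisDual R Λ →ₗ[R] MatlisModule R) : ∃ x : Λ, φ = eval x := by
  obtain ⟨x, hx⟩ := MatlisModule.exists_eval_eq (R := R) (M := Λ) φ
  exact ⟨x, LinearMap.ext hx⟩

end MatlisDual

/-- The dual `Hom_R(M, E⁰(R/J(R)))` of a right `Λ`-module `M`, a left `Λ`-module. -/
def RightDual (R M : Type u) [CommRing R] [AddCommGroup M] [Module R M] : Type u :=
  M →ₗ[R] MatlisModule R

namespace RightDual

variable {M : Type u} [AddCommGroup M] [Module R M]

noncomputable instance : AddCommGroup (RightDual R M) :=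
  inferInstanceAs (AddCommGroup (M →ₗ[R] MatlisModule R))

noncomputable instance : Module R (RightDual R M) :=
  inferInstanceAs (Module R (M →ₗ[R] MatlisModule R))

instance : FunLike (RightDual R M) M (MatlisModule R) :=
  inferInstanceAs (FunLike (M →ₗ[R] MatlisModule R) M (MatlisModule R))

instance : LinearMapClass (RightDual R M) R M (MatlisModule R) :=
  inferInstanceAs (LinearMapClass (M →ₗ[R] MatlisModule R) R M (MatlisModule R))

/-- A linear functional on `M`, as an element of the dual. -/
def of (f : M →ₗ[R] MatlisModule R) : RightDual R M := f

@[ext] theorem ext {f g : RightDual R M} (h : ∀ x, f x = g x) : f = g := LinearMap.ext h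

@[simp] theorem algebra_smul_apply (r : R) (f : RightDual R M) (x : M) : (r • f) x = r • f x := rfl

theorem eq_of_forall_apply_eq [IsArtinianRing R] {x y : M} (h : ∀ f : RightDual R M, f x = f y) :
    x = y := by
  by_contra hne
  obtain ⟨f, hf⟩ := MatlisModule.exists_apply_ne_zero (R := R) (sub_ne_zero.2 hne)
  exact hf (by rw [map_sub, sub_eq_zero]; exact h (of f))

variable [Module Λᵐᵒᵖ M] [IsScalarTower R Λᵐᵒᵖ M]

/-- The left action `(a f)(x) = f(x a)`. -/
noncomputable instance : Module Λ (RightDual R M) where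
  smul a f := of (LinearMap.comp (f : M →ₗ[R] MatlisModule R)
    (Algebra.lsmul R R M (MulOpposite.op a)))
  one_smul f := ext fun x => congrArg f (one_smul Λᵐᵒᵖ x)
  mul_smul a b f := ext fun x => congrArg f (mul_smul (MulOpposite.op b) (MulOpposite.op a) x)
  smul_zero _ := rfl
  smul_add _ _ _ := rfl
  add_smul a b f := ext fun x =>
    (congrArg f (add_smul (MulOpposite.op a) (MulOpposite.op b) x)).trans (map_add f _ _)
  zero_smul f := ext fun x => (congrArg f (zero_smul Λᵐᵒᵖ x)).trans (map_zero f)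

@[simp] theorem smul_apply (a : Λ) (f : RightDual R M) (x : M) :
    (a • f) x = f (MulOpposite.op a • x) := rfl

instance : IsScalarTower R Λ (RightDual R M) where
  smul_assoc r a f := by ext x; simp [MulOpposite.op_smul]

section map

variable {N P : Type u} [AddCommGroup N] [Module R N] [Module Λᵐᵒᵖ N] [IsScalarTower R Λᵐᵒᵖ N]
  [AddCommGroup P] [Module R P] [Module Λᵐᵒᵖ P] [IsScalarTower R Λᵐᵒᵖ P]

/-- The transpose of a map of right modules. -/
noncomputable def map (f : M →ₗ[Λᵐᵒᵖ] N) : RightDual R N →ₗ[Λ] RightDual R M where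
  toFun u := of (LinearMap.comp (u : N →ₗ[R] MatlisModule R) (f.restrictScalars R))
  map_add' _ _ := rfl
  map_smul' a u := ext fun x => congrArg u (f.map_smul (MulOpposite.op a) x).symm

theorem map_injective {f : M →ₗ[Λᵐᵒᵖ] N} (hf : Function.Surjective f) :
    Function.Injective (map (R := R) f) :=
  fun _ _ huv => ext (hf.forall.2 (DFunLike.congr_fun huv))

theorem map_surjective {f : M →ₗ[Λᵐᵒᵖ] N} (hf : Function.Injective f) :
    Function.Surjective (map (R := R) f) := fun u => by
  obtain ⟨v, hv⟩ := (MatlisModule.injective (R := R)).out (f.restrictScalars R) hf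
    (u : M →ₗ[R] MatlisModule R)
  exact ⟨of v, ext hv⟩

theorem map_exact {f : M →ₗ[Λᵐᵒᵖ] N} {g : N →ₗ[Λᵐᵒᵖ] P} (h : Function.Exact f g)
    (hg : Function.Surjective g) : Function.Exact (map (R := R) g) (map (R := R) f) :=
  LinearMap.exact_lcomp_of_exact_of_surjective (MatlisModule R)
    (f := f.restrictScalars R) (g := g.restrictScalars R) h hg

end map

/-- The map of right modules `M → D(Λ)ᵏ` given by `k` elements of the dual of `M`. -/
noncomputable def toPi {k : ℕ} (u : Fin k → RightDual R M) :
    M →ₗ[Λᵐᵒᵖ] (Fin k → MatlisDual R Λ) :=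
  LinearMap.pi fun i =>
    { toFun := fun m => MatlisDual.of ((u i : M →ₗ[R] MatlisModule R) ∘ₗ
        (LinearMap.toSpanSingleton Λᵐᵒᵖ M m).restrictScalars R ∘ₗ
          (MulOpposite.opLinearEquiv R).toLinearMap)
      map_add' := fun m m' => MatlisDual.ext fun x =>
        (congrArg (u i) (smul_add (MulOpposite.op x) m m')).trans (map_add (u i) _ _)
      map_smul' := fun a m => MatlisDual.ext fun x =>
        congrArg (u i) (mul_smul (MulOpposite.op x) a m).symm }

theorem sum_smul_apply {k : ℕ} (u : Fin k → RightDual R M) (c : Fin k → Λ) (m : M) :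
    (∑ i, c i • u i) m = ∑ i, toPi u m i (c i) :=
  LinearMap.sum_apply (M₂ := MatlisModule R) _ _ _

variable [IsArtinianRing R]

theorem toPi_injective {k : ℕ} {u : Fin k → RightDual R M}
    (hu : Submodule.span Λ (Set.range u) = ⊤) : Function.Injective (toPi (Λ := Λ) u) := by
  rw [injective_iff_map_eq_zero]
  intro m hm
  refine eq_of_forall_apply_eq (R := R) fun f => ?_
  obtain ⟨c, rfl⟩ := (Submodule.mem_span_range_iff_exists_fun Λ).1
    (hu ▸ Submodule.mem_top : f ∈ Submodule.span Λ (Set.range u))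
  rw [map_zero, sum_smul_apply, hm]
  exact Finset.sum_eq_zero fun i _ => rfl

variable [Module.Finite R M]

theorem exists_span_eq_top :
    ∃ (k : ℕ) (u : Fin k → RightDual R M), Submodule.span Λ (Set.range u) = ⊤ := by
  have : Module.Finite R (RightDual R M) := MatlisModule.finite_dual M
  have : Module.Finite Λ (RightDual R M) := Module.Finite.of_restrictScalars_finite R Λ _
  exact Module.Finite.exists_fin

theorem injective_of_projective (hM : Module.Projective Λ (RightDual R M)) :
    Module.Injective Λᵐᵒᵖ M := by
  refine Module.Baer.injective fun I f => ?_
  obtain ⟨g, hg⟩ := Module.projective_lifting_property (map (R := R) I.subtype) (map (R := R) f)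
    (map_surjective I.subtype_injective)
  obtain ⟨m, hm⟩ := MatlisModule.exists_eval_eq (R := R) (M := M)
    { toFun := fun u => g (of u) 1
      map_add' := fun x y => congrArg (fun v => v 1) (map_add g (of x) (of y))
      map_smul' := fun r x => congrArg (fun v => v 1) (LinearMap.map_smul_of_tower g r (of x)) }
  refine ⟨LinearMap.toSpanSingleton Λᵐᵒᵖ M m, fun a ha =>
    eq_of_forall_apply_eq (R := R) fun u => ?_⟩
  have apply_one : g (a.unop • u) 1 = (a.unop • u) m := hm _
  rw [map_smul, smul_apply, smul_apply, MulOpposite.op_unop, smul_eq_mul, mul_one] at apply_one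
  exact apply_one.symm.trans (DFunLike.congr_fun (LinearMap.congr_fun hg u) ⟨a, ha⟩)

variable [Module.Finite R Λ]

theorem projective_of_injective (hM : Module.Injective Λᵐᵒᵖ M) :
    Module.Projective Λ (RightDual R M) := by
  classical
  obtain ⟨k, u, hu⟩ := exists_span_eq_top (R := R) (Λ := Λ) (M := M)
  obtain ⟨r, hr⟩ := hM.out (toPi (Λ := Λ) u) (toPi_injective hu) LinearMap.id
  have hcoord (v : RightDual R M) (i : Fin k) : ∃ c : Λ, ∀ w : MatlisDual R Λ,
      v (r (Pi.single i w)) = w c := by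
    obtain ⟨x, hx⟩ := MatlisDual.exists_eval_eq ((v : M →ₗ[R] MatlisModule R) ∘ₗ
      r.restrictScalars R ∘ₗ LinearMap.single R (fun _ => MatlisDual R Λ) i)
    exact ⟨x, LinearMap.congr_fun hx⟩
  choose c hc using hcoord
  let s : RightDual R M →ₗ[Λ] (Fin k → Λ) :=
    { toFun := fun v i => c v i
      map_add' := fun v v' => funext fun i => MatlisDual.eq_of_forall_apply_eq fun w => by
        rw [← hc, Pi.add_apply, map_add, ← hc, ← hc]; rfl
      map_smul' := fun a v => funext fun i => MatlisDual.eq_of_forall_apply_eq fun w => by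
        rw [← hc, smul_apply, ← map_smul, ← Pi.single_smul, hc]; rfl }
  refine Module.Projective.of_split s (Fintype.linearCombination Λ u) (LinearMap.ext fun v =>
    ext fun m => ?_)
  calc (∑ i, c v i • u i) m = ∑ i, toPi u m i (c v i) := sum_smul_apply u (c v) m
    _ = ∑ i, v (r (Pi.single i (toPi u m i))) := Finset.sum_congr rfl fun i _ => (hc v i _).symm
    _ = v (r (∑ i, Pi.single i (toPi u m i))) := by rw [map_sum, map_sum]
    _ = v m := by rw [Finset.univ_sum_single, hr]; rfl

theorem hasProjectiveDimensionLT_iff (m : ℕ) (M : Type u) [AddCommGroup M] [Module R M]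
    [Module Λᵐᵒᵖ M] [IsScalarTower R Λᵐᵒᵖ M] [Module.Finite R M] :
    HasProjectiveDimensionLT (ModuleCat.of Λ (RightDual R M)) (m + 1) ↔
      HasInjectiveDimensionLT (ModuleCat.of Λᵐᵒᵖ M) (m + 1) := by
  induction m generalizing M with
  | zero =>
    rw [zero_add, ← projective_iff_hasProjectiveDimensionLT_one,
      ← injective_iff_hasInjectiveDimensionLT_one, ← Module.injective_iff_injective_object,
      ← IsProjective.iff_projective]
    exact ⟨injective_of_projective, projective_of_injective⟩
  | succ m ih =>
    obtain ⟨k, u, hu⟩ := exists_span_eq_top (R := R) (Λ := Λ) (M := M)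
    have := MatlisDual.finite (R := R) (Λ := Λ)
    have : Module.Injective Λᵐᵒᵖ (MatlisDual R Λ) := MatlisDual.injective_right
    have hI : Module.Injective Λᵐᵒᵖ (Fin k → MatlisDual R Λ) := inferInstance
    have hP : Module.Projective Λ (RightDual R (Fin k → MatlisDual R Λ)) :=
      projective_of_injective hI
    have hinj := toPi_injective hu
    have hex := LinearMap.exact_map_mkQ_range (toPi (Λ := Λ) u)
    have hsurj := Submodule.mkQ_surjective (LinearMap.range (toPi (Λ := Λ) u))
    have hS := shortExact_of_exact hinj hex hsurj
    have hS' := shortExact_of_exact (map_injective hsurj) (map_exact (R := R) hex hsurj)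
      (map_surjective hinj)
    rw [hS'.hasProjectiveDimensionLT_X₃_iff m ((IsProjective.iff_projective _).1 hP)]
    exact (ih _).trans
      (hS.hasInjectiveDimensionLT_X₃_iff m (Module.injective_object_of_injective_module Λᵐᵒᵖ _))

end RightDual

theorem MatlisDual.hasProjectiveDimensionLT_iff [IsArtinianRing R] [Module.Finite R Λ] (m : ℕ) :
    HasProjectiveDimensionLT (ModuleCat.of Λ (MatlisDual R Λ)) (m + 1) ↔
      HasInjectiveDimensionLT (ModuleCat.of Λᵐᵒᵖ Λ) (m + 1) :=
  RightDual.hasProjectiveDimensionLT_iff (R := R) m Λ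

end Duality

/-! ### Embeddings into direct sums of an injective cogenerator -/

section Finsupp

variable {A : Type u} [Ring A]

theorem exists_finset_forall_apply_eq_zero {J M N : Type*} [AddCommGroup M] [Module A M]
    [AddCommGroup N] [Module A N] [Module.Finite A N] (f : N →ₗ[A] (J →₀ M)) :
    ∃ t : Finset J, ∀ j ∉ t, ∀ x, f x j = 0 := by
  classical
  obtain ⟨s, hs⟩ := Module.Finite.fg_top (R := A) (M := N)
  refine ⟨s.biUnion fun x => (f x).support, fun j hj x => ?_⟩
  have hle : Submodule.span A (s : Set N) ≤ LinearMap.ker (Finsupp.lapply j ∘ₗ f) :=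
    Submodule.span_le.2 fun y hy => Finsupp.notMem_support_iff.1 fun hyj =>
      hj (Finset.mem_biUnion.2 ⟨y, hy, hyj⟩)
  exact hle (hs ▸ Submodule.mem_top)

theorem injective_finsupp [IsNoetherianRing A] {M : Type u} [AddCommGroup M] [Module A M]
    (hM : Module.Injective A M) (J : Type u) : Module.Injective A (J →₀ M) := by
  classical
  refine Module.Baer.injective fun I g => ?_
  obtain ⟨t, ht⟩ := exists_finset_forall_apply_eq_zero g
  let incl : (t → M) →ₗ[A] (J →₀ M) :=
    Finsupp.lmapDomain M A ((↑) : t → J) ∘ₗ (Finsupp.linearEquivFunOnFinite A M t).symm.toLinearMap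
  obtain ⟨h, hh⟩ := (inferInstance : Module.Injective A (t → M)).out I.subtype I.subtype_injective
    (LinearMap.pi fun j => Finsupp.lapply (j : J) ∘ₗ g)
  refine ⟨incl ∘ₗ h, fun x hx => Finsupp.ext fun j => ?_⟩
  rw [LinearMap.comp_apply, show h x = _ from hh ⟨x, hx⟩]
  by_cases hj : j ∈ t
  · exact Finsupp.mapDomain_apply Subtype.val_injective _ (⟨j, hj⟩ : t)
  · rw [ht j hj]
    exact Finsupp.mapDomain_of_notMem_range _ _ (by simpa using hj)

variable (A) in
/-- The socle of a module, the sum of its simple submodules. -/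
def socle (M : Type*) [AddCommGroup M] [Module A M] : Submodule A M :=
  sSup {S | IsSimpleModule A S}

instance {M : Type*} [AddCommGroup M] [Module A M] : IsSemisimpleModule A (socle A M) := by
  rw [socle, sSup_eq_iSup]
  exact isSemisimpleModule_biSup_of_isSemisimpleModule_submodule
    fun S (_ : IsSimpleModule A S) => inferInstanceAs (IsSemisimpleModule A S)

theorem exists_isSimpleModule_le [IsArtinianRing A] {M : Type*} [AddCommGroup M] [Module A M]
    {N : Submodule A M} (hN : N ≠ ⊥) : ∃ S ≤ N, IsSimpleModule A S := by
  obtain ⟨x, hx, hx0⟩ := Submodule.exists_mem_ne_zero_of_ne_bot hN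
  have : IsArtinian A (Submodule.span A {x}) :=
    isArtinian_of_fg_of_artinian _ (Submodule.fg_span_singleton x)
  have : Nontrivial (Submodule.span A {x}) :=
    Submodule.nontrivial_iff_ne_bot.2 (Submodule.span_singleton_eq_bot.not.2 hx0)
  obtain ⟨S, hS⟩ := IsAtomic.exists_atom (Submodule A (Submodule.span A {x}))
  have : IsSimpleModule A S := isSimpleModule_iff_isAtom.2 hS
  refine ⟨S.map (Submodule.span A {x}).subtype, (Submodule.map_subtype_le _ S).trans
    ((Submodule.span_singleton_le_iff_mem x N).2 hx), ?_⟩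
  exact IsSimpleModule.congr
    (Submodule.equivMapOfInjective _ (Submodule.injective_subtype _) S).symm

theorem eq_bot_of_disjoint_socle [IsArtinianRing A] {M : Type*} [AddCommGroup M] [Module A M]
    {N : Submodule A M} (hN : Disjoint N (socle A M)) : N = ⊥ := by
  by_contra hne
  obtain ⟨S, hSN, hS⟩ := exists_isSimpleModule_le hne
  exact (isSimpleModule_iff_isAtom.1 hS).1 (le_bot_iff.1 (hN hSN (le_sSup hS)))

variable {E : Type u} [AddCommGroup E] [Module A E]
  (hcog : ∀ (S : Type u) [AddCommGroup S] [Module A S] [IsSimpleModule A S],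
    ∃ f : S →ₗ[A] E, f ≠ 0) (M : Type u) [AddCommGroup M] [Module A M]

include hcog

theorem exists_injective_finsupp_of_isSemisimpleModule [IsSemisimpleModule A M] :
    ∃ (J : Type u) (f : M →ₗ[A] (J →₀ E)), Function.Injective f := by
  classical
  obtain ⟨s, e, -, hs⟩ := IsSemisimpleModule.exists_linearEquiv_dfinsupp A M
  choose f hf using fun m : s => hcog m.1
  have hinj (m : s) : Function.Injective (f m) :=
    (LinearMap.injective_or_eq_zero (f m)).resolve_right (hf m)
  exact ⟨s, (finsuppLequivDFinsupp A).symm.toLinearMap ∘ₗ DFinsupp.mapRange.linearMap f ∘ₗ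
    e.toLinearMap, (finsuppLequivDFinsupp A).symm.injective.comp
      (((DFinsupp.mapRange_injective _ fun m => (f m).map_zero).2 hinj).comp e.injective)⟩

/-- The socle embeds into a direct sum of copies of `E`, and the embedding extends to `M` because
the direct sum is injective. -/
theorem exists_injective_finsupp [IsArtinianRing A] (hE : Module.Injective A E) :
    ∃ (J : Type u) (f : M →ₗ[A] (J →₀ E)), Function.Injective f := by
  obtain ⟨J, φ, hφ⟩ := exists_injective_finsupp_of_isSemisimpleModule hcog (socle A M)
  obtain ⟨ψ, hψ⟩ := (injective_finsupp hE J).out (socle A M).subtype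
    (socle A M).subtype_injective φ
  refine ⟨J, ψ, LinearMap.ker_eq_bot.1 (eq_bot_of_disjoint_socle ?_)⟩
  rw [Submodule.disjoint_def]
  intro x hx hxs
  exact congrArg Subtype.val (hφ (a₁ := ⟨x, hxs⟩) (a₂ := 0)
    ((hψ ⟨x, hxs⟩).symm.trans (hx.trans (map_zero φ).symm)))

end Finsupp

/-! ### The tensor-hom adjunction of a bimodule -/

section TensorHom

variable (R S : Type u) [Ring R] [Ring S] {ω : Type u} [AddCommGroup ω] [Module R ω]
  [Module Sᵐᵒᵖ ω]

namespace BalancedTensor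

variable {N : Type u} [AddCommGroup N] [Module S N]

/-- The pure tensor `x ⊗ y` in `ω ⊗_S N`. -/
def tmul (x : ω) (y : N) : BalancedTensor R S ω N :=
  Submodule.Quotient.mk (x ⊗ₜ[ℤ] y)

theorem tmul_smul (x : ω) (s : S) (y : N) :
    tmul R S x (s • y) = tmul R S (MulOpposite.op s • x) y := by
  symm
  exact (Submodule.Quotient.eq _).2 (Submodule.subset_span ⟨x, s, y, rfl⟩)

theorem tmul_add (x : ω) (y z : N) : tmul R S x (y + z) = tmul R S x y + tmul R S x z := by
  simp only [tmul, TensorProduct.tmul_add, Submodule.Quotient.mk_add]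

theorem add_tmul (x x' : ω) (y : N) : tmul R S (x + x') y = tmul R S x y + tmul R S x' y := by
  simp only [tmul, TensorProduct.add_tmul, Submodule.Quotient.mk_add]

theorem tmul_zero (x : ω) : tmul R S x (0 : N) = 0 := by
  simp only [tmul, TensorProduct.tmul_zero, Submodule.Quotient.mk_zero]

theorem smul_tmul (r : R) (x : ω) (y : N) : tmul R S (r • x) y = r • tmul R S x y := rfl

variable {R S}

theorem hom_ext {M : Type u} [AddCommGroup M] [Module R M] {f g : BalancedTensor R S ω N →ₗ[R] M}
    (h : ∀ x y, f (tmul R S x y) = g (tmul R S x y)) : f = g :=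
  Submodule.linearMap_qext _ (TensorProduct.AlgebraTensorModule.ext h)

/-- The linear map on `ω ⊗_S N` induced by a balanced biadditive map. -/
noncomputable def lift {M : Type u} [AddCommGroup M] [Module R M] (b : ω →ₗ[R] N →ₗ[ℤ] M)
    (hb : ∀ x (s : S) y, b (MulOpposite.op s • x) y = b x (s • y)) :
    BalancedTensor R S ω N →ₗ[R] M :=
  Submodule.liftQ _ (TensorProduct.AlgebraTensorModule.lift b) (by
    refine Submodule.span_le.2 ?_
    rintro _ ⟨x, s, f, rfl⟩
    change _ = _
    rw [map_sub, sub_eq_zero]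
    exact hb x s f)

end BalancedTensor

open BalancedTensor

variable (ω)

/-- The map `x ↦ x ⊗ y`. -/
def tmulRight {N : Type u} [AddCommGroup N] [Module S N] (y : N) :
    ω →ₗ[R] BalancedTensor R S ω N where
  toFun x := tmul R S x y
  map_add' x x' := add_tmul R S x x' y
  map_smul' r x := smul_tmul R S r x y

variable [SMulCommClass R Sᵐᵒᵖ ω]

/-- The unit `y ↦ (x ↦ x ⊗ y)` of the tensor-hom adjunction. -/
noncomputable def coevalMap (N : Type u) [AddCommGroup N] [Module S N] :
    N →ₗ[S] BimodHom R ω (BalancedTensor R S ω N) where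
  toFun y := tmulRight R S ω y
  map_add' y z := LinearMap.ext fun x => tmul_add R S x y z
  map_smul' s y := LinearMap.ext fun x => tmul_smul R S x s y

/-- The adjunction between `ω ⊗_S -` and `Hom_R(ω, -)`, with the evaluation as counit. -/
noncomputable def tensorHomAdjunction : tensorFunctor R S ω ⊣ homFunctor R S ω :=
  Adjunction.mkOfUnitCounit
    { unit := { app := fun N => ModuleCat.ofHom (coevalMap R S ω N)
                naturality := fun _ _ _ => rfl }
      counit := evalTrans R S ω
      left_triangle := by
        ext N : 3
        exact hom_ext fun _ _ => rfl
      right_triangle := rfl }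

/-- The map `x ⊗ f ↦ (j ↦ x f(j))` from `ω ⊗_S S^(J)` to `ω^(J)`. -/
noncomputable def tensorFinsuppMap (J : Type u) :
    BalancedTensor R S ω (J →₀ S) →ₗ[R] (J →₀ ω) :=
  BalancedTensor.lift
    { toFun := fun x => (Finsupp.mapRange.addMonoidHom
          { toFun := fun s => MulOpposite.op s • x
            map_zero' := zero_smul _ x
            map_add' := fun s t => add_smul (MulOpposite.op s) (MulOpposite.op t) x
              }).toIntLinearMap
      map_add' := fun x y => LinearMap.ext fun f => Finsupp.ext fun j =>
        smul_add (MulOpposite.op (f j)) x y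
      map_smul' := fun r x => LinearMap.ext fun f => Finsupp.ext fun j =>
        (smul_comm r (MulOpposite.op (f j)) x).symm }
    (fun x s f => Finsupp.ext fun j => (mul_smul (MulOpposite.op (f j)) (MulOpposite.op s) x).symm)

theorem tensorFinsuppMap_tmul_apply (J : Type u) (x : ω) (f : J →₀ S) (j : J) :
    tensorFinsuppMap R S ω J (tmul R S x f) j = MulOpposite.op (f j) • x := rfl

theorem tensorFinsuppMap_tmul_single (J : Type u) (x : ω) (s : S) (j : J) :
    tensorFinsuppMap R S ω J (tmul R S x (Finsupp.single j s)) =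
      Finsupp.single j (MulOpposite.op s • x) := by
  classical
  refine Finsupp.ext fun k => ?_
  rw [tensorFinsuppMap_tmul_apply, Finsupp.single_apply, Finsupp.single_apply]
  split_ifs
  exacts [rfl, zero_smul _ x]

/-- The isomorphism `ω ⊗_S S^(J) ≅ ω^(J)`. -/
noncomputable def tensorFinsuppEquiv (J : Type u) :
    BalancedTensor R S ω (J →₀ S) ≃ₗ[R] (J →₀ ω) :=
  LinearEquiv.ofLinearMap (tensorFinsuppMap R S ω J)
    (Finsupp.lsum ℕ fun j => tmulRight R S ω (Finsupp.single j 1 : J →₀ S))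
    (by
      refine Finsupp.lhom_ext fun j x => ?_
      rw [LinearMap.comp_apply, Finsupp.lsum_single]
      exact (tensorFinsuppMap_tmul_single R S ω J x 1 j).trans (by
        rw [MulOpposite.op_one, one_smul]; rfl))
    (by
      refine hom_ext fun x f => ?_
      induction f using Finsupp.induction_linear with
      | zero => rw [tmul_zero, map_zero, map_zero]
      | add f g hf hg => rw [tmul_add, map_add, map_add, hf, hg]
      | single j s =>
        rw [LinearMap.comp_apply, LinearMap.id_apply, tensorFinsuppMap_tmul_single,
          Finsupp.lsum_single, ← Finsupp.smul_single_one j s, tmul_smul]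
        rfl)

end TensorHom

/-! ### The dualizing bimodule of an artin algebra -/

theorem isArtinianRing_of_finite (R Λ : Type u) [CommRing R] [IsArtinianRing R] [Ring Λ]
    [Algebra R Λ] [Module.Finite R Λ] : IsArtinianRing Λ :=
  isArtinian_of_tower R (inferInstance : IsArtinian R Λ)

theorem exists_retract_finsupp {A : Type u} [Ring A] (P : ModuleCat.{u} A) [Projective P] :
    ∃ J : Type u, Nonempty (Retract P (ModuleCat.of A (J →₀ A))) := by
  obtain ⟨s, hs⟩ := ((IsProjective.iff_projective P).2 inferInstance : Module.Projective A P).out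
  exact ⟨P, ⟨⟨ModuleCat.ofHom s, ModuleCat.ofHom (Finsupp.linearCombination A id),
    ModuleCat.hom_ext (LinearMap.ext hs)⟩⟩⟩

instance {A : Type u} [Ring A] (J : Type u) : Projective (ModuleCat.of A (J →₀ A)) :=
  (IsProjective.iff_projective _).1 inferInstance

instance {A : Type u} [Ring A] : Projective (ModuleCat.of.{u} A A) :=
  (IsProjective.iff_projective _).1 inferInstance

theorem isIso_app_of_retract {C D : Type*} [Category* C] [Category* D] {F G : C ⥤ D} (τ : F ⟶ G)
    {X Y : C} (r : Retract X Y) [hY : IsIso (τ.app Y)] : IsIso (τ.app X) :=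
  (MorphismProperty.isomorphisms D).of_retract (NatTrans.retractArrowApp τ r) hY

section MatlisDual

variable {R Λ : Type u} [CommRing R] [IsArtinianRing R] [Ring Λ] [Algebra R Λ]

namespace MatlisDual

theorem exists_hom_apply_ne_zero {M : Type u} [AddCommGroup M] [Module Λ M] {m : M} (hm : m ≠ 0) :
    ∃ f : M →ₗ[Λ] MatlisDual R Λ, f m ≠ 0 := by
  let _ : Module R M := Module.compHom M (algebraMap R Λ)
  have : IsScalarTower R Λ M := ⟨fun r a x => by
    rw [Algebra.smul_def, mul_smul]; rfl⟩
  obtain ⟨f, hf⟩ := MatlisModule.exists_apply_ne_zero (R := R) hm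
  refine ⟨{ toFun := fun x => of (f ∘ₗ (LinearMap.toSpanSingleton Λ M x).restrictScalars R)
            map_add' := fun x y => ext fun a =>
              (congrArg f (smul_add a x y)).trans (map_add f _ _)
            map_smul' := fun a x => ext fun b => congrArg f (mul_smul b a x).symm },
    fun h => hf ?_⟩
  exact (congrArg f (one_smul Λ m)).symm.trans (DFunLike.congr_fun h (1 : Λ))

variable (R) in
theorem exists_hom_tensor_regular_apply_ne_zero {M : ModuleCat.{u} Λ} {z : M} (hz : z ≠ 0) :
    ∃ f : M ⟶ (tensorFunctor Λ Λ (MatlisDual R Λ)).obj (ModuleCat.of Λ Λ), f z ≠ 0 := by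
  obtain ⟨φ, hφ⟩ := exists_hom_apply_ne_zero (R := R) (Λ := Λ) hz
  refine ⟨ModuleCat.ofHom (tmulRight Λ Λ (MatlisDual R Λ) (1 : Λ) ∘ₗ φ), fun h => hφ ?_⟩
  have tmul_single_eq_zero :
      BalancedTensor.tmul Λ Λ (φ z) (Finsupp.single PUnit.unit (1 : Λ)) = 0 :=
    (congrArg (balancedTensorMap Λ Λ (MatlisDual R Λ) (Finsupp.lsingle PUnit.unit)) h).trans
      (map_zero _)
  have single_eq_zero := tensorFinsuppMap_tmul_single Λ Λ (MatlisDual R Λ) PUnit (φ z) 1 PUnit.unit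
  rw [tmul_single_eq_zero, map_zero, MulOpposite.op_one, one_smul] at single_eq_zero
  exact Finsupp.single_eq_zero.1 single_eq_zero.symm

variable (R Λ) in
theorem coevalMap_finsupp_injective (J : Type u) :
    Function.Injective (coevalMap Λ Λ (MatlisDual R Λ) (J →₀ Λ)) := by
  refine (injective_iff_map_eq_zero _).2 fun f hf => Finsupp.ext fun j =>
    eq_of_forall_apply_eq (R := R) fun w => ?_
  have tmul_eq_zero : BalancedTensor.tmul Λ Λ w f = 0 :=
    LinearMap.congr_fun (show tmulRight Λ Λ (MatlisDual R Λ) f = 0 from hf) w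
  have op_smul_eq_zero : MulOpposite.op (f j) • w = 0 := by
    rw [← tensorFinsuppMap_tmul_apply Λ Λ, tmul_eq_zero, map_zero, Finsupp.zero_apply]
  have apply_one : (MulOpposite.op (f j) • w) 1 = 0 := DFunLike.congr_fun op_smul_eq_zero 1
  simpa [op_smul_apply] using apply_one

variable [Module.Finite R Λ]

theorem exists_hom_eq (h : MatlisDual R Λ →ₗ[Λ] MatlisDual R Λ) :
    ∃ a : Λ, ∀ w, h w = MulOpposite.op a • w := by
  obtain ⟨a, ha⟩ := exists_eval_eq (eval 1 ∘ₗ h.restrictScalars R)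
  exact ⟨a, fun w => ext fun x => by simpa using LinearMap.congr_fun ha (x • w)⟩

/-- The components of a map from `D(Λ)` to a direct sum of copies of `D(Λ)` are right
multiplications, and almost all of them vanish because `D(Λ)` is finitely generated. -/
theorem coevalMap_finsupp_surjective (J : Type u) :
    Function.Surjective (coevalMap Λ Λ (MatlisDual R Λ) (J →₀ Λ)) := by
  classical
  intro h
  let e := tensorFinsuppEquiv Λ Λ (MatlisDual R Λ) J
  let h' : MatlisDual R Λ →ₗ[Λ] (J →₀ MatlisDual R Λ) := e.toLinearMap ∘ₗ h
  obtain ⟨t, ht⟩ := exists_finset_forall_apply_eq_zero h'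
  choose a ha using fun j => exists_hom_eq (Finsupp.lapply j ∘ₗ h')
  refine ⟨Finsupp.onFinset t (fun j => if j ∈ t then a j else 0) (by simp_all), ?_⟩
  refine LinearMap.ext fun w => e.injective (Finsupp.ext fun j => ?_)
  refine (tensorFinsuppMap_tmul_apply Λ Λ (MatlisDual R Λ) J w _ j).trans ?_
  change _ = h' w j
  by_cases hj : j ∈ t
  · simpa [hj] using (ha j w).symm
  · simp [ht j hj w, hj]

variable (R Λ) in
theorem injective_tensor_finsupp (J : Type u) :
    Injective ((tensorFunctor Λ Λ (MatlisDual R Λ)).obj (ModuleCat.of Λ (J →₀ Λ))) := by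
  have := isArtinianRing_of_finite R Λ
  have := injective_finsupp (injective_left (R := R) (Λ := Λ)) J
  exact Injective.of_iso (tensorFinsuppEquiv Λ Λ (MatlisDual R Λ) J).symm.toModuleIso
    (Module.injective_object_of_injective_module Λ (J →₀ MatlisDual R Λ))

end MatlisDual

variable (R) [Module.Finite R Λ]

theorem isIso_unit_app_finsupp (J : Type u) :
    IsIso ((tensorHomAdjunction Λ Λ (MatlisDual R Λ)).unit.app (ModuleCat.of Λ (J →₀ Λ))) :=
  (ConcreteCategory.isIso_iff_bijective _).2
    ⟨MatlisDual.coevalMap_finsupp_injective R Λ J, MatlisDual.coevalMap_finsupp_surjective J⟩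

theorem isIso_unit_app_of_projective (P : ModuleCat.{u} Λ) [Projective P] :
    IsIso ((tensorHomAdjunction Λ Λ (MatlisDual R Λ)).unit.app P) := by
  obtain ⟨J, ⟨r⟩⟩ := exists_retract_finsupp P
  have := isIso_unit_app_finsupp R (Λ := Λ) J
  exact isIso_app_of_retract _ r

theorem injective_tensorFunctor_obj (P : ModuleCat.{u} Λ) [Projective P] :
    Injective ((tensorFunctor Λ Λ (MatlisDual R Λ)).obj P) := by
  obtain ⟨J, ⟨r⟩⟩ := exists_retract_finsupp P
  have := MatlisDual.injective_tensor_finsupp R Λ J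
  exact (r.map _).injective

theorem exists_retract_tensor_finsupp (I : ModuleCat.{u} Λ) [Injective I] :
    ∃ J : Type u, Nonempty (Retract I
      ((tensorFunctor Λ Λ (MatlisDual R Λ)).obj (ModuleCat.of Λ (J →₀ Λ)))) := by
  have := isArtinianRing_of_finite R Λ
  obtain ⟨J, f, hf⟩ := exists_injective_finsupp (E := MatlisDual R Λ) (fun S _ _ _ => by
    have := IsSimpleModule.nontrivial Λ S
    obtain ⟨x, hx⟩ := exists_ne (0 : S)
    obtain ⟨f, hf⟩ := MatlisDual.exists_hom_apply_ne_zero (R := R) (Λ := Λ) hx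
    exact ⟨f, fun h => hf (by rw [h, LinearMap.zero_apply])⟩) I MatlisDual.injective_left
  let k : I ⟶ (tensorFunctor Λ Λ (MatlisDual R Λ)).obj (ModuleCat.of Λ (J →₀ Λ)) :=
    ModuleCat.ofHom ((tensorFinsuppEquiv Λ Λ (MatlisDual R Λ) J).symm.toLinearMap ∘ₗ f)
  have : Mono k := (ModuleCat.mono_iff_injective k).2
    ((tensorFinsuppEquiv Λ Λ (MatlisDual R Λ) J).symm.injective.comp hf)
  exact ⟨J, ⟨⟨k, Injective.factorThru (𝟙 I) k, Injective.comp_factorThru _ _⟩⟩⟩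

theorem isIso_counit_app_of_injective (I : ModuleCat.{u} Λ) [Injective I] :
    IsIso ((tensorHomAdjunction Λ Λ (MatlisDual R Λ)).counit.app I) := by
  obtain ⟨J, ⟨r⟩⟩ := exists_retract_tensor_finsupp R I
  have := isIso_unit_app_finsupp R (Λ := Λ) J
  have : IsIso ((tensorHomAdjunction Λ Λ (MatlisDual R Λ)).counit.app
      ((tensorFunctor Λ Λ (MatlisDual R Λ)).obj (ModuleCat.of Λ (J →₀ Λ)))) :=
    IsIso.of_isIso_fac_left (h := 𝟙 _)
      ((tensorHomAdjunction Λ Λ (MatlisDual R Λ)).left_triangle_components _)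
  exact isIso_app_of_retract _ r

theorem projective_homFunctor_obj (I : ModuleCat.{u} Λ) [Injective I] :
    Projective ((homFunctor Λ Λ (MatlisDual R Λ)).obj I) := by
  obtain ⟨J, ⟨r⟩⟩ := exists_retract_tensor_finsupp R I
  have := isIso_unit_app_finsupp R (Λ := Λ) J
  have : Projective ((homFunctor Λ Λ (MatlisDual R Λ)).obj
      ((tensorFunctor Λ Λ (MatlisDual R Λ)).obj (ModuleCat.of Λ (J →₀ Λ)))) :=
    Projective.of_iso (asIso ((tensorHomAdjunction Λ Λ (MatlisDual R Λ)).unit.app _)) inferInstance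
  exact (r.map (homFunctor Λ Λ (MatlisDual R Λ))).projective

end MatlisDual

/-! ### Homological dimensions and simple modules -/

section FiniteLength

open Abelian

variable {A : Type u} [Ring A]

theorem prop_of_isFiniteLength (𝒬 : ObjectProperty (ModuleCat.{u} A))
    [𝒬.IsClosedUnderExtensions] (h0 : ∀ Z, IsZero Z → 𝒬 Z)
    (h : ∀ T : ModuleCat.{u} A, IsSimpleModule A T → 𝒬 T) (M : Type u) [AddCommGroup M] [Module A M]
    (hM : IsFiniteLength A M) : 𝒬 (ModuleCat.of A M) := by
  induction hM with
  | @of_subsingleton M => exact h0 _ (ModuleCat.isZero_of_subsingleton (ModuleCat.of A M))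
  | @of_simple_quotient M _ _ N hN _ ih =>
    exact 𝒬.prop_X₂_of_shortExact (shortExact_of_exact N.subtype_injective
      (LinearMap.exact_subtype_mkQ N) N.mkQ_surjective) ih (h (ModuleCat.of A (M ⧸ N)) hN)

theorem subsingleton_ext_of_isFiniteLength {X : ModuleCat.{u} A} {n : ℕ}
    (h : ∀ T : ModuleCat.{u} A, IsSimpleModule A T → Subsingleton (Ext X T n))
    (M : Type u) [AddCommGroup M] [Module A M] (hM : IsFiniteLength A M) :
    Subsingleton (Ext X (ModuleCat.of A M) n) := by
  let 𝒬 : ObjectProperty (ModuleCat.{u} A) := fun T => Subsingleton (Ext X T n)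
  have : 𝒬.IsClosedUnderExtensions := ⟨fun hS h₁ h₃ => subsingleton_ext_right_X₂ hS h₁ h₃⟩
  refine prop_of_isFiniteLength 𝒬 (fun Z hZ => ?_) h M hM
  have := hZ.hasInjectiveDimensionLT_zero
  exact HasInjectiveDimensionLT.subsingleton Z 0 n n.zero_le X

theorem exists_finite_projective_surjective (M : ModuleCat.{u} A) [Module.Finite A M] :
    ∃ (P : ModuleCat.{u} A) (p : P ⟶ M), Function.Surjective p.hom ∧ Projective P ∧
      Module.Finite A P := by
  obtain ⟨k, p, hp⟩ := Module.Finite.exists_fin' A M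
  exact ⟨ModuleCat.of A (Fin k → A), ModuleCat.ofHom p, hp,
    (IsProjective.iff_projective _).1 inferInstance, inferInstanceAs (Module.Finite A (Fin k → A))⟩

theorem exists_shortExact_regular_of_isSimpleModule (T : ModuleCat.{u} A) [IsSimpleModule A T] :
    ∃ (K : ModuleCat.{u} A) (f : K ⟶ ModuleCat.of A A) (g : ModuleCat.of A A ⟶ T) (w : f ≫ g = 0),
      (ShortComplex.mk f g w).ShortExact := by
  have := IsSimpleModule.nontrivial A T
  obtain ⟨x, hx⟩ := exists_ne (0 : T)
  have hs : Function.Surjective (LinearMap.toSpanSingleton A T x) :=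
    IsSimpleModule.toSpanSingleton_surjective A hx
  exact ⟨_, _, _, _, LinearMap.shortExact_shortComplexKer hs⟩

variable [IsArtinianRing A]

theorem hasProjectiveDimensionLT_of_subsingleton_ext_simple (n : ℕ) (M : ModuleCat.{u} A)
    [Module.Finite A M]
    (h : ∀ T : ModuleCat.{u} A, IsSimpleModule A T → Subsingleton (Ext M T (n + 1))) :
    HasProjectiveDimensionLT M (n + 1) := by
  induction n generalizing M with
  | zero =>
    obtain ⟨P, p, hp, _, _⟩ := exists_finite_projective_surjective M
    obtain ⟨s, hs⟩ := exists_lift_of_subsingleton_ext (LinearMap.shortExact_shortComplexKer hp)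
      (subsingleton_ext_of_isFiniteLength h (LinearMap.ker p.hom)
        (isFiniteLength_iff_isNoetherian_isArtinian.2 ⟨inferInstance, inferInstance⟩)) (𝟙 M)
    have : Projective M := Retract.projective (Y := P) ⟨s, p, hs⟩
    infer_instance
  | succ n ih =>
    obtain ⟨P, p, hp, _, _⟩ := exists_finite_projective_surjective M
    have hS := LinearMap.shortExact_shortComplexKer hp
    refine (hS.hasProjectiveDimensionLT_X₃_iff n ‹_›).2 (ih _ fun T hT => ?_)
    exact subsingleton_ext_left_X₁ hS (extOrthogonal.of_projective P T n) (h T hT)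

theorem hasProjectiveDimensionLT_of_hasInjectiveDimensionLT_self {m : ℕ}
    [HasInjectiveDimensionLT (ModuleCat.of.{u} A A) (m + 1)] (M : ModuleCat.{u} A)
    [Module.Finite A M] {d : ℕ} (hd : HasProjectiveDimensionLT M d) :
    HasProjectiveDimensionLT M (m + 1) := by
  obtain hdm | hdm := le_total d (m + 1)
  · exact hasProjectiveDimensionLT_of_ge M d (m + 1) hdm
  induction d, hdm using Nat.le_induction with
  | base => exact hd
  | succ d hdm ih =>
    refine ih ?_
    obtain ⟨d, rfl⟩ := Nat.exists_eq_add_of_le' (Nat.one_le_of_lt hdm)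
    refine hasProjectiveDimensionLT_of_subsingleton_ext_simple d M fun T _ => ?_
    obtain ⟨_, _, _, _, hS⟩ := exists_shortExact_regular_of_isSimpleModule T
    exact subsingleton_ext_right_X₃ hS (HasInjectiveDimensionLT.subsingleton _ (m + 1) _ hdm M)
      (HasProjectiveDimensionLT.subsingleton M (d + 1 + 1) _ le_rfl _)

end FiniteLength

theorem injectiveDimension_congr {C D : Type*} [Category* C] [Category* D] [Abelian C] [Abelian D]
    {X : C} {Y : D} (h : ∀ m, HasInjectiveDimensionLT X m ↔ HasInjectiveDimensionLT Y m) :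
    injectiveDimension X = injectiveDimension Y := by
  simp only [injectiveDimension, h]

/-! ### Truncated injective resolutions -/

section Truncation

open CochainComplex

variable {D : Type*} [Category* D] [Abelian D]

theorem exists_quasiIso_truncLE {K L : CochainComplex D ℤ} (φ : K ⟶ L) [QuasiIso φ] (n : ℤ)
    [K.IsStrictlyLE n] : ∃ ψ : K ⟶ L.truncLE n, QuasiIso ψ :=
  have : QuasiIso (truncLEMap φ n) := by
    rw [quasiIso_truncLEMap_iff]
    exact fun i _ => inferInstance
  ⟨inv (ιTruncLE K n) ≫ truncLEMap φ n, inferInstance⟩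

theorem isStrictlyGE_truncLE (K : CochainComplex D ℤ) {a n : ℤ} (h : a ≤ n) [K.IsStrictlyGE a] :
    (K.truncLE n).IsStrictlyGE a := by
  rw [isStrictlyGE_iff]
  exact fun i hi => (K.isZero_of_isStrictlyGE a i hi).of_iso (K.truncLEXIso n i (by lia))

theorem extOrthogonal_truncLE_X [HasExt D] {K : CochainComplex D ℤ} (hK : ∀ i, Injective (K.X i))
    {a : ℤ} (ha : K.IsStrictlyGE a) (hex : ∀ i ≠ 0, K.ExactAt i) (W : D) (n : ℕ)
    [HasProjectiveDimensionLT W (n + 1)] (i : ℤ) : extOrthogonal W ((K.truncLE n).X i) := by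
  obtain hi | rfl | hi := lt_trichotomy i n
  · have : Injective ((K.truncLE n).X i) := Injective.of_iso (K.truncLEXIso n i hi).symm (hK i)
    exact extOrthogonal.of_injective W _
  · refine (extOrthogonal W).prop_of_iso (K.truncLEXIsoCycles n).symm fun j => ?_
    rw [subsingleton_ext_cycles_iff hK ha hex]
    exact HasProjectiveDimensionLT.subsingleton W (n + 1) (n + j + 1) (by lia) _
  · have : Injective ((K.truncLE n).X i) :=
      ((K.truncLE n).isZero_of_isStrictlyLE n i hi).injective
    exact extOrthogonal.of_injective W _

theorem IsDualizing.exists_quasiIso_isBassObject {C : Type*} [Category* C] [Abelian C] [HasExt C]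
    [HasExt D] [EnoughInjectives D] {F : C ⥤ D} {G : D ⥤ C} [F.Additive] [G.Additive] {adj : F ⊣ G}
    {W : D} {A : C} (h : IsDualizing adj W A) {d : ℕ} (hd : HasInjectiveDimensionLT A d) (n : ℕ)
    [HasProjectiveDimensionLT W (n + 1)] (M : D) :
    ∃ (Y : CochainComplex D ℤ)
      (φ : (HomologicalComplex.single D (ComplexShape.up ℤ) 0).obj M ⟶ Y),
      QuasiIso φ ∧ (∃ a : ℤ, Y.IsStrictlyGE a ∧ Y.IsStrictlyLE (a + n)) ∧
      ∀ i : ℤ, IsBassObject adj W A (Y.X i) := by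
  let I := (InjectiveResolution.of M).cochainComplex
  let ι : (HomologicalComplex.single D (ComplexShape.up ℤ) 0).obj M ⟶ I :=
    (InjectiveResolution.of M).ι'
  have : QuasiIso ι := inferInstanceAs (QuasiIso (InjectiveResolution.of M).ι')
  have := isStrictlyLE_of_le
    ((HomologicalComplex.single D (ComplexShape.up ℤ) 0).obj M) 0 n (by lia)
  obtain ⟨φ, hφ⟩ := exists_quasiIso_truncLE ι n
  refine ⟨I.truncLE n, φ, hφ, ⟨0, isStrictlyGE_truncLE I (by lia), ?_⟩, fun i =>
    h.isBassObject_of_extOrthogonal hd (extOrthogonal_truncLE_X (a := 0) (fun _ => inferInstance)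
      inferInstance (exactAt_of_quasiIso_single ι) W n i)⟩
  rw [zero_add]
  infer_instance

end Truncation

/-! ### Gorenstein artin algebras -/

section Bimodule

variable (R S : Type u) [Ring R] [Ring S] (ω : Type u) [AddCommGroup ω] [Module R ω]
  [Module Sᵐᵒᵖ ω]

theorem isStrictlyLE_tensorComplex (P : CochainComplex (ModuleCat.{u} S) ℤ) (b : ℤ)
    [P.IsStrictlyLE b] : (tensorComplex R S ω P).IsStrictlyLE b := by
  rw [CochainComplex.isStrictlyLE_iff]
  exact fun i hi => (tensorFunctor R S ω).map_isZero (P.isZero_of_isStrictlyLE b i hi)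

variable [SMulCommClass R Sᵐᵒᵖ ω]

theorem isStrictlyGE_homComplex (I : CochainComplex (ModuleCat.{u} R) ℤ) (a : ℤ)
    [I.IsStrictlyGE a] : (homComplex R S ω I).IsStrictlyGE a := by
  rw [CochainComplex.isStrictlyGE_iff]
  exact fun i hi => (homFunctor R S ω).map_isZero (I.isZero_of_isStrictlyGE a i hi)

variable {R S ω}

theorem bassInjectiveDimension_le_iff {M : CochainComplex (ModuleCat.{u} R) ℤ} {n : ℕ} :
    bassInjectiveDimension R S ω M ≤ n ↔ IsBassComplex R S ω M ∧ supRHom R S ω M ≤ n := by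
  rw [bassInjectiveDimension]
  split_ifs with hM
  · simp only [hM, true_and]
  · simp only [hM, false_and, iff_false, top_le_iff]
    exact EReal.coe_ne_top n

end Bimodule

section ArtinAlgebra

open Abelian CochainComplex ZeroObject

variable (R Λ : Type u) [CommRing R] [IsArtinianRing R] [Ring Λ] [Algebra R Λ]
  [Module.Finite R Λ]

theorem isDualizing_matlisDual :
    IsDualizing (tensorHomAdjunction Λ Λ (MatlisDual R Λ)) (ModuleCat.of Λ (MatlisDual R Λ))
      (ModuleCat.of Λ Λ) where
  isIso_unit P _ := isIso_unit_app_of_projective R P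
  isIso_counit I _ := isIso_counit_app_of_injective R I
  injective P _ := injective_tensorFunctor_obj R P
  projective I _ := projective_homFunctor_obj R I
  projective_regular := inferInstance
  isZero X hX := by
    rw [ModuleCat.isZero_iff_subsingleton]
    refine subsingleton_of_forall_eq 0 fun z => ?_
    by_contra hz
    obtain ⟨f, hf⟩ := MatlisDual.exists_hom_tensor_regular_apply_ne_zero R hz
    exact hf (by rw [hX f]; rfl)
  epi_iff {X Y} g := by
    rw [ModuleCat.epi_iff_surjective]
    constructor
    · intro hg f
      obtain ⟨f', hf'⟩ := hg f.hom
      exact ⟨ModuleCat.ofHom (show MatlisDual R Λ →ₗ[Λ] X from f'), ModuleCat.hom_ext hf'⟩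
    · intro hg f
      obtain ⟨f', hf'⟩ := hg (ModuleCat.ofHom (show MatlisDual R Λ →ₗ[Λ] Y from f))
      exact ⟨f'.hom, congrArg ModuleCat.Hom.hom hf'⟩

variable {Λ}

theorem isBass_iff (X : ModuleCat.{u} Λ) :
    IsBass Λ Λ (MatlisDual R Λ) X ↔
      IsBassObject (tensorHomAdjunction Λ Λ (MatlisDual R Λ)) (ModuleCat.of Λ (MatlisDual R Λ))
        (ModuleCat.of Λ Λ) X := by
  have h := isDualizing_matlisDual R Λ
  constructor
  · intro hX
    exact ⟨fun i => subsingleton_of_forall_eq 0 (hX.ext_eq_zero (i + 1) (by lia)),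
      fun i => (h.isZero_leftDerived_iff _ i).1 (hX.tor_isZero (i + 1) (by lia)),
      (ConcreteCategory.isIso_iff_bijective _).2 hX.static⟩
  · intro hX
    refine ⟨fun i hi e => ?_, fun i hi => ?_,
      (ConcreteCategory.isIso_iff_bijective _).1 hX.isIso_counit⟩
    · obtain ⟨i, rfl⟩ := Nat.exists_eq_add_of_le' hi
      exact (hX.orthogonal i).elim _ _
    · obtain ⟨i, rfl⟩ := Nat.exists_eq_add_of_le' hi
      exact (h.isZero_leftDerived_iff _ i).2 (hX.orthogonal_right i)

theorem hasProjectiveDimensionLT_matlisDual {n : ℕ}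
    (h : ∀ T : ModuleCat.{u} Λ, IsSimpleModule Λ T →
      Subsingleton (Ext (ModuleCat.of Λ (MatlisDual R Λ)) T (n + 1))) :
    HasProjectiveDimensionLT (ModuleCat.of Λ (MatlisDual R Λ)) (n + 1) :=
  have := isArtinianRing_of_finite R Λ
  have : Module.Finite Λ (ModuleCat.of Λ (MatlisDual R Λ)) :=
    inferInstanceAs (Module.Finite Λ (MatlisDual R Λ))
  hasProjectiveDimensionLT_of_subsingleton_ext_simple n _ h

theorem hasProjectiveDimensionLT_matlisDual_iff {n d : ℕ}
    (hn : HasProjectiveDimensionLT (ModuleCat.of Λ (MatlisDual R Λ)) n)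
    (hd : HasInjectiveDimensionLT (ModuleCat.of.{u} Λ Λ) d) (m : ℕ) :
    HasProjectiveDimensionLT (ModuleCat.of Λ (MatlisDual R Λ)) (m + 1) ↔
      HasInjectiveDimensionLT (ModuleCat.of.{u} Λ Λ) (m + 1) := by
  have h := isDualizing_matlisDual R Λ
  constructor
  · intro hm
    exact (h.hasPrecover_of_hasPreenvelope (h.hasPreenvelope_of_subsingleton_ext hd fun i hi =>
      HasProjectiveDimensionLT.subsingleton _ (m + 1) (i + 1) (by lia) _)).hasInjectiveDimensionLT
  · intro hm
    have := isArtinianRing_of_finite R Λ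
    have : Module.Finite Λ (ModuleCat.of Λ (MatlisDual R Λ)) :=
      inferInstanceAs (Module.Finite Λ (MatlisDual R Λ))
    exact hasProjectiveDimensionLT_of_hasInjectiveDimensionLT_self _ hn

theorem finiteInjectiveDimension_of_hasPrecover
    (h : ∀ T : ModuleCat.{u} Λ, IsSimpleModule Λ T → HasPrecover
      (extOrthogonal (ModuleCat.of Λ (MatlisDual R Λ))) (finiteInjectiveDimension _) T) :
    finiteInjectiveDimension (ModuleCat.{u} Λ) (ModuleCat.of Λ Λ) := by
  have := isArtinianRing_of_finite R Λ
  have := (isDualizing_matlisDual R Λ).isClosedUnderExtensions_hasPrecover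
  refine HasPrecover.finiteInjectiveDimension (prop_of_isFiniteLength (HasPrecover _ _)
    (fun Z hZ => ?_) h Λ (isFiniteLength_iff_isNoetherian_isArtinian.2
      ⟨inferInstance, inferInstance⟩))
  have := (isZero_zero (ModuleCat.{u} Λ)).injective
  exact HasPrecover.of_prop (extOrthogonal.of_injective _ 0) ⟨0, hZ.hasInjectiveDimensionLT_zero⟩

theorem isGorensteinAlgebra_of_hasProjectiveDimensionLT {n : ℕ}
    (hn : HasProjectiveDimensionLT (ModuleCat.of Λ (MatlisDual R Λ)) (n + 1))
    (hΛ : finiteInjectiveDimension (ModuleCat.{u} Λ) (ModuleCat.of Λ Λ)) :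
    IsGorensteinAlgebra Λ ∧ HasInjectiveDimensionLT (ModuleCat.of.{u} Λ Λ) (n + 1) := by
  obtain ⟨d, hd⟩ := hΛ
  have pd_iff := hasProjectiveDimensionLT_matlisDual_iff R hn hd
  refine ⟨⟨injectiveDimension_congr fun m => ?_, ?_⟩, (pd_iff n).1 hn⟩
  · cases m with
    | zero =>
      rw [hasInjectiveDimensionLT_zero_iff_isZero, hasInjectiveDimensionLT_zero_iff_isZero,
        ModuleCat.isZero_iff_subsingleton, ModuleCat.isZero_iff_subsingleton]
    | succ m => exact (pd_iff m).symm.trans (MatlisDual.hasProjectiveDimensionLT_iff m)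
  · exact lt_top_iff_ne_top.2 ((injectiveDimension_ne_top_iff _).2
      ⟨d, hasInjectiveDimensionLT_of_ge _ d _ (Nat.le_succ d)⟩)

theorem isGorensteinAlgebra_of_hasPrecover {n : ℕ}
    (h : ∀ T : ModuleCat.{u} Λ, IsSimpleModule Λ T → HasPrecover
      (extOrthogonal (ModuleCat.of Λ (MatlisDual R Λ))) (injectiveDimensionLT _ (n + 1)) T) :
    IsGorensteinAlgebra Λ ∧ HasInjectiveDimensionLT (ModuleCat.of.{u} Λ Λ) (n + 1) :=
  isGorensteinAlgebra_of_hasProjectiveDimensionLT R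
    (hasProjectiveDimensionLT_matlisDual R fun T hT => (h T hT).subsingleton_ext)
    (finiteInjectiveDimension_of_hasPrecover R fun T hT =>
      (h T hT).mono le_rfl (injectiveDimensionLT_le_finiteInjectiveDimension _))

theorem IsGorensteinAlgebra.hasProjectiveDimensionLT_matlisDual (h : IsGorensteinAlgebra Λ) {n : ℕ}
    (hn : HasInjectiveDimensionLT (ModuleCat.of.{u} Λ Λ) (n + 1)) :
    HasProjectiveDimensionLT (ModuleCat.of Λ (MatlisDual R Λ)) (n + 1) :=
  (MatlisDual.hasProjectiveDimensionLT_iff n).2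
    ((injectiveDimension_le_iff _ n).1 (h.1 ▸ (injectiveDimension_le_iff _ n).2 hn))

theorem IsBassComplex.hasPrecover {n : ℕ}
    (hn : HasProjectiveDimensionLT (ModuleCat.of Λ (MatlisDual R Λ)) (n + 1))
    {T : ModuleCat.{u} Λ} (hT : IsBassComplex Λ Λ (MatlisDual R Λ)
      ((HomologicalComplex.single (ModuleCat.{u} Λ) (ComplexShape.up ℤ) 0).obj T)) :
    HasPrecover (extOrthogonal (ModuleCat.of Λ (MatlisDual R Λ))) (finiteInjectiveDimension _)
      T := by
  have h := isDualizing_matlisDual R Λ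
  obtain ⟨-, I, ι, ⟨_, -, -⟩, -, P, π, ⟨-, _, b, _⟩, _⟩ := hT
  let ε : tensorComplex Λ Λ (MatlisDual R Λ) P ⟶ I :=
    ((tensorFunctor Λ Λ (MatlisDual R Λ)).mapHomologicalComplex _).map π ≫
      evalComplex Λ Λ (MatlisDual R Λ) I
  have hV : ∀ i, Injective ((tensorComplex Λ Λ (MatlisDual R Λ) P).X i) :=
    fun i => injective_tensorFunctor_obj R (P.X i)
  have hex : ∀ i ≠ 0, (tensorComplex Λ Λ (MatlisDual R Λ) P).ExactAt i := fun i hi =>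
    (exactAt_iff_of_quasiIsoAt ε i).2 (exactAt_of_quasiIso_single ι i hi)
  have := isStrictlyLE_tensorComplex Λ Λ (MatlisDual R Λ) P b
  have : (tensorComplex Λ Λ (MatlisDual R Λ) P).IsStrictlyLE (0 + b.toNat) :=
    isStrictlyLE_of_le _ b _ (by lia)
  have hB := extOrthogonal_boundaries_of_hasProjectiveDimensionLT (m := 0)
    (fun i _ => extOrthogonal.of_injective (ModuleCat.of Λ (MatlisDual R Λ)) _)
    (fun i hi => hex i hi.ne) (n + 1)
  exact ((h.hasPrecover_homology (m := 0) (n := b.toNat) (fun i _ => h.isBassObject_of_injective _)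
    (fun i hi => hex i hi.ne') hB).mono le_rfl
      (injectiveDimensionLT_le_finiteInjectiveDimension _)).of_iso
        (isoOfQuasiIsoAt ε 0 ≪≫ homologyIsoOfQuasiIsoSingle ι)

theorem isGorensteinAlgebra_of_bassInjectiveDimension_le {n : ℕ}
    (h : ∀ T : ModuleCat.{u} Λ, IsSimpleModule Λ T →
      bassInjectiveDimension Λ Λ (MatlisDual R Λ)
        ((HomologicalComplex.single (ModuleCat.{u} Λ) (ComplexShape.up ℤ) 0).obj T) ≤ n) :
    IsGorensteinAlgebra Λ ∧ HasInjectiveDimensionLT (ModuleCat.of.{u} Λ Λ) (n + 1) := by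
  simp only [bassInjectiveDimension_le_iff, supRHom_single_le_iff] at h
  have hn := hasProjectiveDimensionLT_matlisDual R fun T hT => (h T hT).2 n le_rfl
  exact isGorensteinAlgebra_of_hasProjectiveDimensionLT R hn
    (finiteInjectiveDimension_of_hasPrecover R fun T hT => (h T hT).1.hasPrecover R hn)

theorem isIso_evalComplex (I : CochainComplex (ModuleCat.{u} Λ) ℤ) [∀ i, Injective (I.X i)] :
    IsIso (evalComplex Λ Λ (MatlisDual R Λ) I) :=
  have (i : ℤ) : IsIso ((evalComplex Λ Λ (MatlisDual R Λ) I).f i) :=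
    isIso_counit_app_of_injective R (I.X i)
  HomologicalComplex.Hom.isIso_of_components _

theorem isBassComplex_single {n d : ℕ}
    (hn : HasProjectiveDimensionLT (ModuleCat.of Λ (MatlisDual R Λ)) (n + 1))
    (hd : HasInjectiveDimensionLT (ModuleCat.of.{u} Λ Λ) d) (T : ModuleCat.{u} Λ) :
    IsBassComplex Λ Λ (MatlisDual R Λ)
      ((HomologicalComplex.single (ModuleCat.{u} Λ) (ComplexShape.up ℤ) 0).obj T) := by
  have hres := isInjRes_injectiveResolution (InjectiveResolution.of T)
  let I := (InjectiveResolution.of T).cochainComplex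
  have hI : ∀ i, Injective (I.X i) := hres.injective
  have hGE := isStrictlyGE_homComplex Λ Λ (MatlisDual R Λ) I 0
  have hLE : (homComplex Λ Λ (MatlisDual R Λ) I).IsLE n := by
    rw [isLE_iff]
    intro i hi
    obtain ⟨k, rfl⟩ : ∃ k : ℕ, i = k + 1 := ⟨(i - 1).toNat, by lia⟩
    exact (hres.exactAt_homComplex_iff k).2
      (HasProjectiveDimensionLT.subsingleton _ (n + 1) (k + 1) (by lia) T)
  obtain ⟨P, π, _, hP, hP'⟩ :=
    exists_quasiIso_projective ((homComplex Λ Λ (MatlisDual R Λ) I).truncLE n) n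
  have hG : ∀ i, Projective ((homComplex Λ Λ (MatlisDual R Λ) I).X i) :=
    fun i => projective_homFunctor_obj R (I.X i)
  refine ⟨⟨0, 0, inferInstance, inferInstance⟩, I, _, hres, ⟨0, n, inferInstance, hLE⟩, P,
    π ≫ ιTruncLE _ n, ⟨inferInstance, hP, n, hP'⟩, ?_⟩
  have := (isDualizing_matlisDual R Λ).quasiIso_map hd (π ≫ ιTruncLE _ n) hP hG
  have := isIso_evalComplex R I
  infer_instance

theorem bassInjectiveDimension_single_le {n d : ℕ}
    (hn : HasProjectiveDimensionLT (ModuleCat.of Λ (MatlisDual R Λ)) (n + 1))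
    (hd : HasInjectiveDimensionLT (ModuleCat.of.{u} Λ Λ) d) (T : ModuleCat.{u} Λ) :
    bassInjectiveDimension Λ Λ (MatlisDual R Λ)
      ((HomologicalComplex.single (ModuleCat.{u} Λ) (ComplexShape.up ℤ) 0).obj T) ≤ n := by
  rw [bassInjectiveDimension_le_iff, supRHom_single_le_iff]
  exact ⟨isBassComplex_single R hn hd T, fun i hi =>
    HasProjectiveDimensionLT.subsingleton _ (n + 1) (i + 1) (by lia) T⟩

end ArtinAlgebra

theorem corollary5p6 (R Λ : Type u) [CommRing R] [IsArtinianRing R] [Ring Λ] [Algebra R Λ]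
    [Module.Finite R Λ] (n : ℕ) :
    List.TFAE [
      IsGorensteinAlgebra Λ ∧ injectiveDimension (ModuleCat.of.{u} Λ Λ) ≤ n,
      ∀ T : ModuleCat.{u} Λ, IsSimpleModule Λ T →
        bassInjectiveDimension Λ Λ (MatlisDual R Λ)
          ((HomologicalComplex.single (ModuleCat.{u} Λ) (ComplexShape.up ℤ) 0).obj T) ≤ n,
      ∀ T : ModuleCat.{u} Λ, IsSimpleModule Λ T →
        ∃ (Y : CochainComplex (ModuleCat.{u} Λ) ℤ)
          (φ : (HomologicalComplex.single (ModuleCat.{u} Λ) (ComplexShape.up ℤ) 0).obj T ⟶ Y),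
          QuasiIso φ ∧ (∃ a : ℤ, Y.IsStrictlyGE a ∧ Y.IsStrictlyLE (a + n)) ∧
          ∀ i : ℤ, IsBass Λ Λ (MatlisDual R Λ) (Y.X i),
      ∀ T : ModuleCat.{u} Λ, IsSimpleModule Λ T →
        ∃ (X W : ModuleCat.{u} Λ) (f : T ⟶ X) (g : X ⟶ W) (w : f ≫ g = 0),
          (ShortComplex.mk f g w).ShortExact ∧ IsBass Λ Λ (MatlisDual R Λ) X ∧
          injectiveDimension W < n,
      ∀ T : ModuleCat.{u} Λ, IsSimpleModule Λ T →
        ∃ (X W : ModuleCat.{u} Λ) (f : X ⟶ W) (g : W ⟶ T) (w : f ≫ g = 0),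
          (ShortComplex.mk f g w).ShortExact ∧ IsBass Λ Λ (MatlisDual R Λ) X ∧
          injectiveDimension W ≤ n] := by
  simp only [isBass_iff R, injectiveDimension_le_iff, injectiveDimension_lt_iff]
  have h := isDualizing_matlisDual R Λ
  tfae_have 1 → 2 := fun ⟨hΛ, hn⟩ T _ =>
    bassInjectiveDimension_single_le R (hΛ.hasProjectiveDimensionLT_matlisDual R hn) hn T
  tfae_have 1 → 3 := fun ⟨hΛ, hn⟩ T _ =>
    have := hΛ.hasProjectiveDimensionLT_matlisDual R hn
    h.exists_quasiIso_isBassObject hn n T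
  tfae_have 1 → 4 := fun ⟨hΛ, hn⟩ T _ => h.hasPreenvelope_of_subsingleton_ext hn fun i hi =>
    have := hΛ.hasProjectiveDimensionLT_matlisDual R hn
    HasProjectiveDimensionLT.subsingleton _ (n + 1) (i + 1) (by lia) T
  tfae_have 2 → 1 := isGorensteinAlgebra_of_bassInjectiveDimension_le R
  tfae_have 3 → 1 := fun hT => isGorensteinAlgebra_of_hasPrecover R fun T hT' => by
    obtain ⟨Y, φ, _, ⟨a, _, _⟩, hY⟩ := hT T hT'
    have := IsSimpleModule.nontrivial Λ T
    exact h.hasPrecover_of_quasiIso (a := a)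
      (fun h0 => not_subsingleton T (ModuleCat.isZero_iff_subsingleton.1 h0)) φ hY
  tfae_have 4 → 5 := fun hT T hT' => h.hasPrecover_of_hasPreenvelope (hT T hT')
  tfae_have 5 → 1 := fun hT => isGorensteinAlgebra_of_hasPrecover R fun T hT' =>
    HasPrecover.mono (fun X hX => hX.orthogonal) le_rfl (hT T hT')
  tfae_finish
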